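/- For $1\le a<b\le 4$ let $\lambda_{ab}\subset\mathbb{Z}_{\ge 0}^2$ be a finite partition, i.e. a finite (possibly empty) subset such that $(i,j)\in\lambda_{ab}$, $0\le i'\le i$, $0\le j'\le j$ imply $(i',j')\in\lambda_{ab}$; assume that the six partitions are not all empty. Write $\{1,2,3,4\}=\{a,b,c,d\}$ with $c<d$, and let $Z_{\lambda_{ab}}\subset\mathbb{C}^4$ be the closed subscheme whose ideal in $\mathbb{C}[x_1,x_2,x_3,x_4]$ is spanned by the monomials $x_1^{i_1}x_2^{i_2}x_3^{i_3}x_4^{i_4}$ with $(i_c,i_d)\notin\lambda_{ab}$. It is a (possibly empty) thickening of the plane $x_c=x_d=0$. Let $Z_{\boldsymbol\lambda}=\bigcup_{a<b}Z_{\lambda_{ab}}$, the closed subscheme of $\mathbb{C}^4$ whose ideal is spanned by the monomials that lie in the ideals of all six $Z_{\lambda_{ab}}$; these are the $(\mathbb{C}^*)^4$-invariant pure 2-dimensional closed subschemes of $\mathbb{C}^4$. Consider the scheme-theoretic intersection $$W=(Z_{\lambda_{12}}\cup Z_{\lambda_{13}}\cup Z_{\lambda_{23}})\cap(Z_{\lambda_{14}}\cup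 Z_{\lambda_{24}}\cup Z_{\lambda_{34}}).$$ Call $W$ pure if every nonzero coherent subsheaf of $\mathcal{O}_W$ has support of dimension $\dim W$, and impure otherwise. Then one of the following four cases occurs: 1. if $W$ is empty, then $Z_{\boldsymbol\lambda}$ is Cohen–Macaulay; 2. if $W$ is $0$-dimensional, then $Z_{\boldsymbol\lambda}$ is not Cohen–Macaulay; 3. if $W$ is $1$-dimensional and impure, then $Z_{\boldsymbol\lambda}$ is not Cohen–Macaulay; 4. if $W$ is $1$-dimensional and pure, then $Z_{\boldsymbol\lambda}$ is Cohen–Macaulay. Consequently $Z_{\boldsymbol\lambda}$ is Cohen–Macaulay if and only if $W$ is empty or $W$ is $1$-dimensional and pure. -/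

import Mathlib

open MvPolynomial

/-- The coordinate ring `ℂ[x₁, x₂, x₃, x₄]` of `ℂ⁴`. The coordinate `x_k` is the
variable with index `k - 1` in `Fin 4`. A closed subscheme of `ℂ⁴` is given by its ideal `I` here;
it is the spectrum of `CoordRing ⧸ I`, the union of two closed subschemes is given by the
intersection `I ⊓ J`, and their scheme-theoretic intersection by the sum `I ⊔ J`. -/
abbrev CoordRing : Type := MvPolynomial (Fin 4) ℂ

/-- The monomial ideal generated by the monomials `x^i` with `i ∉ π`. For a solid partition `π`
(a lower set of exponents) the monomials outside the ideal are exactly the `x^i` with `i ∈ π`. -/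
noncomputable def monomialIdeal (π : Set (Fin 4 →₀ ℕ)) : Ideal CoordRing :=
  Ideal.span ((fun i : Fin 4 →₀ ℕ => (monomial i (1 : ℂ) : CoordRing)) '' πᶜ)

/-- Six finite partitions `λ_ab`, `1 ≤ a < b ≤ 4`, each a finite lower set in `ℕ × ℕ`
(possibly empty). -/
structure SixPartitions where
  l12 : YoungDiagram
  l13 : YoungDiagram
  l14 : YoungDiagram
  l23 : YoungDiagram
  l24 : YoungDiagram
  l34 : YoungDiagram

/-- The exponents `i` with `(i_c, i_d) ∈ μ`, the other two exponents being arbitrary. -/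
def cylinder (c d : Fin 4) (μ : YoungDiagram) : Set (Fin 4 →₀ ℕ) :=
  {i | (i c, i d) ∈ μ}

namespace SixPartitions

variable (L : SixPartitions)

/-- Not all six partitions are empty. -/
def NotAllEmpty : Prop :=
  ¬ (L.l12 = ⊥ ∧ L.l13 = ⊥ ∧ L.l14 = ⊥ ∧ L.l23 = ⊥ ∧ L.l24 = ⊥ ∧ L.l34 = ⊥)

/-! The solid partitions of the components: that of `Z_{λ_ab}` consists of the exponents `i` with
`(i_c, i_d) ∈ λ_ab`, where `{a, b, c, d} = {1, 2, 3, 4}` and `c < d`. So `Z_{λ_ab}` is a thickening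
of the plane `x_c = x_d = 0`, on which `x_a`, `x_b` are coordinates. -/

/-- The solid partition of `Z_{λ₁₂}`. -/
def π12 : Set (Fin 4 →₀ ℕ) := cylinder 2 3 L.l12

/-- The solid partition of `Z_{λ₁₃}`. -/
def π13 : Set (Fin 4 →₀ ℕ) := cylinder 1 3 L.l13

/-- The solid partition of `Z_{λ₁₄}`. -/
def π14 : Set (Fin 4 →₀ ℕ) := cylinder 1 2 L.l14

/-- The solid partition of `Z_{λ₂₃}`. -/
def π23 : Set (Fin 4 →₀ ℕ) := cylinder 0 3 L.l23

/-- The solid partition of `Z_{λ₂₄}`. -/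
def π24 : Set (Fin 4 →₀ ℕ) := cylinder 0 2 L.l24

/-- The solid partition of `Z_{λ₃₄}`. -/
def π34 : Set (Fin 4 →₀ ℕ) := cylinder 0 1 L.l34

/-- The ideal of `Z_λ`: a monomial survives in the coordinate ring of `Z_λ` if and only if its
exponent lies in one of the six solid partitions above. -/
noncomputable def idealZ : Ideal CoordRing :=
  monomialIdeal (L.π12 ∪ L.π13 ∪ L.π14 ∪ L.π23 ∪ L.π24 ∪ L.π34)

/-- The ideal of `W = (Z_{λ₁₂} ∪ Z_{λ₁₃} ∪ Z_{λ₂₃}) ∩ (Z_{λ₁₄} ∪ Z_{λ₂₄} ∪ Z_{λ₃₄})`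
(scheme-theoretic unions and intersection). -/
noncomputable def idealW : Ideal CoordRing :=
  (monomialIdeal L.π12 ⊓ monomialIdeal L.π13 ⊓ monomialIdeal L.π23) ⊔
    (monomialIdeal L.π14 ⊓ monomialIdeal L.π24 ⊓ monomialIdeal L.π34)

end SixPartitions

/-- The depth of a local ring: the supremum of the lengths of the regular sequences contained in
the maximal ideal. -/
noncomputable def localDepth (A : Type*) [CommRing A] [IsLocalRing A] : ℕ∞ :=
  ⨆ (rs : List A) (_ : (∀ r ∈ rs, r ∈ IsLocalRing.maximalIdeal A) ∧
    RingTheory.Sequence.IsRegular A rs), (rs.length : ℕ∞)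

/-- A ring (equivalently its spectrum) is Cohen-Macaulay if it is Noetherian and all its local
rings have depth equal to their Krull dimension. -/
def IsCohenMacaulayRing (A : Type*) [CommRing A] : Prop :=
  IsNoetherianRing A ∧ ∀ (p : Ideal A) [p.IsPrime],
    (localDepth (Localization.AtPrime p) : WithBot ℕ∞) = ringKrullDim (Localization.AtPrime p)

/-- The spectrum of `A` is pure: every nonzero ideal of `A`, i.e. every nonzero coherent subsheaf
of the structure sheaf, has support of the same dimension as `A`. -/
def IsPureRing (A : Type*) [CommRing A] : Prop :=
  ∀ J : Ideal A, J ≠ ⊥ → Module.supportDim A J = ringKrullDim A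

/-- The closed subscheme of `ℂ⁴` with ideal `I` is empty. -/
def SubschemeIsEmpty (I : Ideal CoordRing) : Prop := IsEmpty (PrimeSpectrum (CoordRing ⧸ I))

/-- The dimension of the closed subscheme of `ℂ⁴` with ideal `I` (`⊥` if it is empty). -/
noncomputable def subschemeDim (I : Ideal CoordRing) : WithBot ℕ∞ := ringKrullDim (CoordRing ⧸ I)

/-- The closed subscheme of `ℂ⁴` with ideal `I` is pure. -/
def SubschemeIsPure (I : Ideal CoordRing) : Prop := IsPureRing (CoordRing ⧸ I)

/-- The closed subscheme of `ℂ⁴` with ideal `I` is Cohen-Macaulay. -/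
def SubschemeIsCohenMacaulay (I : Ideal CoordRing) : Prop := IsCohenMacaulayRing (CoordRing ⧸ I)

/-! The six thickened planes are grouped into two halves `Z₁ = Z_{λ₁₂} ∪ Z_{λ₁₃} ∪ Z_{λ₂₃}`,
supported on the hyperplane `x₄ = 0`, and `Z₂ = Z_{λ₁₄} ∪ Z_{λ₂₄} ∪ Z_{λ₃₄}`, the product of a curve
with the `x₄`-axis. Both are Cohen-Macaulay: their coordinate rings have filtrations whose quotients
are coordinate rings of coordinate planes (`SixPartitions.hasCyclicFiltration_idealHyperplane`,
`SixPartitions.hasCyclicFiltration_idealProduct`), found by adjoining the solid partitions cell by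
cell, and suitable pairs of linear forms are regular on each coordinate plane. The exact sequence
`0 → 𝒪_Z → 𝒪_{Z₁} ⊕ 𝒪_{Z₂} → 𝒪_W → 0` then reduces the depth of `Z` to that of `W`, which has
dimension at most one. It is used through elements instead of homologically.

* If a linear form `s` is regular on `W`, the union cut by `s = 0` embeds into the disjoint union of
  the halves cut by `s = 0` (`inf_sup_span_singleton`), so a second linear form is regular on it.
  The zero locus on `W` of the form `x₁ + x₂ + x₃ + x₄ - z` is finite, so the form is regular when
  `W` is pure of dimension one, and trivially so when `W` is empty. This makes `Z` Cohen-Macaulay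
  (`SixPartitions.subschemeIsCohenMacaulay_idealZ`).
* Otherwise some nonzero section `f` of `𝒪_W` is annihilated by the maximal ideal of a point, namely
  an associated prime of an ideal with zero-dimensional support. A regular sequence of length two at
  this point would lift `(f, 0)`, a section on the two halves, to a section of `𝒪_Z`
  (`localDepth_lt_two_of_socle`). Since `Z` has dimension two at every closed point, it is not
  Cohen-Macaulay (`SixPartitions.not_subschemeIsCohenMacaulay_idealZ`).
-/

/-! ### Elements regular modulo an ideal -/

section Regular

variable {R : Type*} [CommRing R]

/-- `r` is a nonzerodivisor on `R ⧸ I`, phrased with elements of `R`; `I = ⊤` is allowed. -/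
def RegularModulo (I : Ideal R) (r : R) : Prop := ∀ f, r * f ∈ I → f ∈ I

theorem RegularModulo.of_isPrime {q : Ideal R} (hq : q.IsPrime) {r : R} (hr : r ∉ q) :
    RegularModulo q r := fun _ hf => (hq.mem_or_mem hf).resolve_left hr

theorem RegularModulo.inf {I J : Ideal R} {r : R} (hI : RegularModulo I r)
    (hJ : RegularModulo J r) : RegularModulo (I ⊓ J) r :=
  fun f hf => ⟨hI f hf.1, hJ f hf.2⟩

/-- If `s` is regular on the intersection `R ⧸ (I ⊔ J)` of two closed subschemes, then the union,
cut by `s = 0`, embeds into the disjoint union of the two pieces, each cut by `s = 0`. -/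
theorem inf_sup_span_singleton {I J : Ideal R} {s : R} (hs : RegularModulo (I ⊔ J) s) :
    (I ⊓ J) ⊔ Ideal.span {s} = (I ⊔ Ideal.span {s}) ⊓ (J ⊔ Ideal.span {s}) := by
  refine le_antisymm (le_inf (sup_le_sup_right inf_le_left _) (sup_le_sup_right inf_le_right _)) ?_
  rintro f ⟨hI, hJ⟩
  obtain ⟨i, hi, a, ha, rfl⟩ := Submodule.mem_sup.1 hI
  obtain ⟨j, hj, b, hb, hab⟩ := Submodule.mem_sup.1 hJ
  obtain ⟨a, rfl⟩ := Ideal.mem_span_singleton'.1 ha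
  obtain ⟨b, rfl⟩ := Ideal.mem_span_singleton'.1 hb
  have hmem : s * (a - b) ∈ I ⊔ J := by
    have : s * (a - b) = j - i := by linear_combination -hab
    rw [this]
    exact sub_mem (Ideal.mem_sup_right hj) (Ideal.mem_sup_left hi)
  obtain ⟨u, hu, v, hv, huv⟩ := Submodule.mem_sup.1 (hs _ hmem)
  refine Submodule.mem_sup.2 ⟨i + s * u, ⟨I.add_mem hi (I.mul_mem_left _ hu), ?_⟩,
    (b + v) * s, Ideal.mem_span_singleton'.2 ⟨_, rfl⟩, ?_⟩
  · have : i + s * u = j - s * v := by linear_combination s * huv - hab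
    rw [this]
    exact J.sub_mem hj (J.mul_mem_left _ hv)
  · linear_combination s * huv

/-- `R ⧸ I` has a finite filtration whose successive quotients are cyclic modules `R ⧸ q` with
`q ∈ S`: either it is zero, or it contains a submodule `(f) ≅ R ⧸ q` whose quotient
`R ⧸ (I ⊔ (f))` has such a filtration. -/
inductive HasCyclicFiltration (S : Set (Ideal R)) : Ideal R → Prop
  | top : HasCyclicFiltration S ⊤
  | step (I : Ideal R) (f : R) (q : Ideal R) (hq : q ∈ S) (hf : ∀ g, g * f ∈ I ↔ g ∈ q)
      (h : HasCyclicFiltration S (I ⊔ Ideal.span {f})) : HasCyclicFiltration S I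

theorem HasCyclicFiltration.regularModulo {S : Set (Ideal R)} {I : Ideal R}
    (h : HasCyclicFiltration S I) {r : R} (hr : ∀ q ∈ S, RegularModulo q r) :
    RegularModulo I r := by
  induction h with
  | top => exact fun _ _ => Submodule.mem_top
  | step I f q hq hf _ ih =>
    intro g hg
    obtain ⟨i, hi, a, ha, rfl⟩ := Submodule.mem_sup.1 (ih g (Ideal.mem_sup_left hg))
    obtain ⟨a, rfl⟩ := Ideal.mem_span_singleton'.1 ha
    refine I.add_mem hi ((hf a).2 (hr q hq a ((hf _).1 ?_)))
    have : r * a * f = r * (i + a * f) - r * i := by ring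
    rw [this]
    exact I.sub_mem hg (I.mul_mem_left _ hi)

theorem HasCyclicFiltration.regularModulo_sup_span {S : Set (Ideal R)} {I : Ideal R}
    (h : HasCyclicFiltration S I) {s t : R} (hs : ∀ q ∈ S, RegularModulo q s)
    (ht : ∀ q ∈ S, RegularModulo (q ⊔ Ideal.span {s}) t) :
    RegularModulo (I ⊔ Ideal.span {s}) t := by
  induction h with
  | top => exact fun _ _ => Ideal.mem_sup_left Submodule.mem_top
  | step I f q hq hf h ih =>
    intro g hg
    obtain ⟨y, hy, b, hb, rfl⟩ :=
      Submodule.mem_sup.1 (ih g ((sup_le_sup_right le_sup_left _ :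
        I ⊔ Ideal.span {s} ≤ I ⊔ Ideal.span {f} ⊔ Ideal.span {s}) hg))
    obtain ⟨i, hi, a, ha, rfl⟩ := Submodule.mem_sup.1 hy
    obtain ⟨a, rfl⟩ := Ideal.mem_span_singleton'.1 ha
    obtain ⟨b, rfl⟩ := Ideal.mem_span_singleton'.1 hb
    obtain ⟨j, hj, c, hc, hjc⟩ := Submodule.mem_sup.1 hg
    obtain ⟨c, rfl⟩ := Ideal.mem_span_singleton'.1 hc
    -- the multiple of `s` occurring in `t * a * f` lies in the next step of the filtration
    have h1 : s * (c - t * b) ∈ I ⊔ Ideal.span {f} := by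
      have : s * (c - t * b) = (t * i - j) + t * a * f := by linear_combination hjc
      rw [this]
      exact Ideal.add_mem _ (Ideal.mem_sup_left (I.sub_mem (I.mul_mem_left _ hi) hj))
        (Ideal.mem_sup_right (Ideal.mem_span_singleton'.2 ⟨_, rfl⟩))
    obtain ⟨k, hk, d, hd, hkd⟩ := Submodule.mem_sup.1 (h.regularModulo hs _ h1)
    obtain ⟨d, rfl⟩ := Ideal.mem_span_singleton'.1 hd
    have h2 : (t * a - s * d) * f ∈ I := by
      have : (t * a - s * d) * f = j - t * i + s * k := by linear_combination -hjc - s * hkd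
      rw [this]
      exact I.add_mem (I.sub_mem hj (I.mul_mem_left _ hi)) (I.mul_mem_left _ hk)
    have h3 : t * a ∈ q ⊔ Ideal.span {s} := by
      have : t * a = (t * a - s * d) + d * s := by ring
      rw [this]
      exact Ideal.add_mem _ (Ideal.mem_sup_left ((hf _).1 h2))
        (Ideal.mem_sup_right (Ideal.mem_span_singleton'.2 ⟨_, rfl⟩))
    obtain ⟨w, hw, e, he, hwe⟩ := Submodule.mem_sup.1 (ht q hq a h3)
    obtain ⟨e, rfl⟩ := Ideal.mem_span_singleton'.1 he
    refine Submodule.mem_sup.2 ⟨i + w * f, I.add_mem hi ((hf w).2 hw), (e * f + b) * s,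
      Ideal.mem_span_singleton'.2 ⟨_, rfl⟩, ?_⟩
    linear_combination f * hwe

theorem RegularModulo.isSMulRegular {I : Ideal R} {r : R} (h : RegularModulo I r) :
    IsSMulRegular (R ⧸ I) (Ideal.Quotient.mk I r) := by
  rw [isSMulRegular_iff_right_eq_zero_of_smul]
  intro x hx
  obtain ⟨x, rfl⟩ := Ideal.Quotient.mk_surjective x
  rw [smul_eq_mul, ← map_mul, Ideal.Quotient.eq_zero_iff_mem] at hx
  exact Ideal.Quotient.eq_zero_iff_mem.2 (h x hx)

theorem isWeaklyRegular_singleton_of_regularModulo {I : Ideal R} {r : R}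
    (h : RegularModulo I r) :
    RingTheory.Sequence.IsWeaklyRegular (R ⧸ I) [Ideal.Quotient.mk I r] :=
  (RingTheory.Sequence.isWeaklyRegular_singleton_iff _ _).2 h.isSMulRegular

open Pointwise in
theorem isWeaklyRegular_pair_of_regularModulo {I : Ideal R} {s t : R}
    (hs : RegularModulo I s) (ht : RegularModulo (I ⊔ Ideal.span {s}) t) :
    RingTheory.Sequence.IsWeaklyRegular (R ⧸ I)
      [Ideal.Quotient.mk I s, Ideal.Quotient.mk I t] := by
  refine (RingTheory.Sequence.isWeaklyRegular_cons_iff _ _ _).2 ⟨hs.isSMulRegular,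
    (RingTheory.Sequence.isWeaklyRegular_singleton_iff _ _).2 ?_⟩
  rw [isSMulRegular_quotient_iff_mem_of_smul_mem]
  intro x hx
  obtain ⟨x, rfl⟩ := Ideal.Quotient.mk_surjective x
  have key : ∀ y : R, Ideal.Quotient.mk I y ∈
      (Ideal.Quotient.mk I s) • (⊤ : Submodule (R ⧸ I) (R ⧸ I)) ↔ y ∈ I ⊔ Ideal.span {s} := by
    intro y
    rw [Submodule.mem_smul_pointwise_iff_exists]
    constructor
    · rintro ⟨z, -, hz⟩
      obtain ⟨z, rfl⟩ := Ideal.Quotient.mk_surjective z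
      rw [smul_eq_mul, ← map_mul, Ideal.Quotient.mk_eq_mk_iff_sub_mem] at hz
      have : y = z * s - (s * z - y) + 0 := by ring
      rw [this, add_zero]
      exact Ideal.sub_mem _ (Ideal.mem_sup_right (Ideal.mem_span_singleton'.2 ⟨_, rfl⟩))
        (Ideal.mem_sup_left hz)
    · intro hy
      obtain ⟨i, hi, a, ha, rfl⟩ := Submodule.mem_sup.1 hy
      obtain ⟨a, rfl⟩ := Ideal.mem_span_singleton'.1 ha
      refine ⟨Ideal.Quotient.mk I a, trivial, ?_⟩
      rw [smul_eq_mul, ← map_mul, Ideal.Quotient.mk_eq_mk_iff_sub_mem]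
      have : s * a - (i + a * s) = -i := by ring
      rw [this]
      exact I.neg_mem hi
  rw [smul_eq_mul, ← map_mul] at hx
  exact (key x).2 (ht x ((key _).1 hx))

end Regular

/-! ### Depth and dimension of local rings of a quotient -/

section Depth

theorem localDepth_le_ringKrullDim (B : Type*) [CommRing B] [IsLocalRing B] [IsNoetherianRing B] :
    (localDepth B : WithBot ℕ∞) ≤ ringKrullDim B := by
  obtain ⟨d, hd⟩ : ∃ d : ℕ∞, ringKrullDim B = d :=
    ⟨_, (WithBot.coe_unbot _ (ringKrullDim_nonneg_of_nontrivial (R := B) |>.trans_lt'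
      (WithBot.bot_lt_coe 0)).ne').symm⟩
  rw [hd, WithBot.coe_le_coe]
  refine iSup₂_le fun rs hrs => ?_
  have h := ringKrullDim_add_length_eq_ringKrullDim_of_isRegular rs hrs.2
  have : Nontrivial (B ⧸ Ideal.ofList rs) := by
    refine Ideal.Quotient.nontrivial_iff.2 fun htop => hrs.2.top_ne_smul ?_
    rw [htop]; simp
  rw [← WithBot.coe_le_coe, ← hd, ← h]
  exact le_add_of_nonneg_left ringKrullDim_nonneg_of_nontrivial

theorem localDepth_eq_ringKrullDim_of_isWeaklyRegular {A : Type*} [CommRing A]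
    [IsNoetherianRing A] (P : Ideal A) [P.IsPrime] {rs : List A}
    (hreg : RingTheory.Sequence.IsWeaklyRegular A rs) (hrs : ∀ r ∈ rs, r ∈ P)
    (hP : P.height ≤ rs.length) :
    (localDepth (Localization.AtPrime P) : WithBot ℕ∞) =
      ringKrullDim (Localization.AtPrime P) := by
  refine le_antisymm (localDepth_le_ringKrullDim _) ?_
  rw [IsLocalization.AtPrime.ringKrullDim_eq_height P, WithBot.coe_le_coe]
  refine hP.trans ?_
  have := hreg.isRegular_of_isLocalization_of_mem (Localization.AtPrime P) P hrs
  refine le_trans ?_ (le_iSup₂ (rs.map (algebraMap A (Localization.AtPrime P))) ⟨?_, this⟩)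
  · simp
  · intro r hr
    obtain ⟨a, ha, rfl⟩ := List.mem_map.1 hr
    exact (IsLocalization.AtPrime.to_map_mem_maximal_iff _ P a).2 (hrs a ha)

open Pointwise in
theorem exists_regular_pair_of_two_le_localDepth {B : Type*} [CommRing B] [IsLocalRing B]
    (h : 2 ≤ localDepth B) :
    ∃ r₁ ∈ IsLocalRing.maximalIdeal B, ∃ r₂ ∈ IsLocalRing.maximalIdeal B,
      (∀ x, r₁ * x = 0 → x = 0) ∧ (∀ x, r₁ ∣ r₂ * x → r₁ ∣ x) := by
  obtain ⟨rs, hrs, hlen⟩ : ∃ rs : List B, ((∀ r ∈ rs, r ∈ IsLocalRing.maximalIdeal B) ∧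
      RingTheory.Sequence.IsRegular B rs) ∧ 2 ≤ rs.length := by
    by_contra! hcon
    have : localDepth B ≤ 1 := by
      refine iSup₂_le fun rs hrs => ?_
      exact_mod_cast Nat.lt_succ_iff.1 (hcon rs hrs)
    exact absurd (h.trans this) (by norm_num)
  match rs, hrs, hlen with
  | r₁ :: r₂ :: rs, hrs, _ =>
    refine ⟨r₁, hrs.1 _ (by simp), r₂, hrs.1 _ (by simp), ?_, ?_⟩
    · have := ((RingTheory.Sequence.isRegular_cons_iff _ _ _).1 hrs.2).1
      exact isSMulRegular_iff_right_eq_zero_of_smul.1 this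
    · have h2 := ((RingTheory.Sequence.isRegular_cons_iff _ _ _).1 hrs.2).2
      have h3 := ((RingTheory.Sequence.isRegular_cons_iff _ _ _).1 h2).1
      rw [isSMulRegular_quotient_iff_mem_of_smul_mem] at h3
      have key : ∀ y : B, y ∈ r₁ • (⊤ : Submodule B B) ↔ r₁ ∣ y := by
        intro y
        rw [Submodule.mem_smul_pointwise_iff_exists]
        exact ⟨fun ⟨z, _, hz⟩ => ⟨z, hz.symm⟩, fun ⟨z, hz⟩ => ⟨z, trivial, hz.symm⟩⟩
      exact fun x hx => (key x).1 (h3 x ((key _).2 hx))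

variable {R : Type*} [CommRing R]

/-- A regular sequence of length two in a local ring of `R ⧸ I`, with denominators cleared. -/
theorem exists_regular_pair_of_two_le_localDepth_quotient {I : Ideal R} (P : Ideal (R ⧸ I))
    [P.IsPrime] (h : 2 ≤ localDepth (Localization.AtPrime P)) :
    ∃ ρ₁ ∈ P.comap (Ideal.Quotient.mk I), ∃ ρ₂ ∈ P.comap (Ideal.Quotient.mk I),
      (∀ a, ρ₁ * a ∈ I → ∃ u ∉ P.comap (Ideal.Quotient.mk I), u * a ∈ I) ∧
      (∀ a, ρ₂ * a ∈ I ⊔ Ideal.span {ρ₁} →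
        ∃ u ∉ P.comap (Ideal.Quotient.mk I), u * a ∈ I ⊔ Ideal.span {ρ₁}) := by
  obtain ⟨r₁, hr₁, r₂, hr₂, h₁, h₂⟩ := exists_regular_pair_of_two_le_localDepth h
  set φ : R →+* Localization.AtPrime P := (algebraMap (R ⧸ I) _).comp (Ideal.Quotient.mk I)
    with hφ
  have hker : ∀ a, φ a = 0 → ∃ u ∉ P.comap (Ideal.Quotient.mk I), u * a ∈ I := by
    intro a ha
    obtain ⟨⟨c, hc⟩, hca⟩ := (IsLocalization.map_eq_zero_iff P.primeCompl _ _).1 ha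
    obtain ⟨c, rfl⟩ := Ideal.Quotient.mk_surjective c
    refine ⟨c, hc, ?_⟩
    rwa [← Ideal.Quotient.eq_zero_iff_mem, map_mul]
  have hkerI : ∀ a ∈ I, φ a = 0 := by
    intro a ha
    simp [hφ, Ideal.Quotient.eq_zero_iff_mem.2 ha]
  have hunit : ∀ u ∉ P.comap (Ideal.Quotient.mk I), IsUnit (φ u) := fun u hu =>
    IsLocalization.map_units (Localization.AtPrime P) (⟨_, hu⟩ : P.primeCompl)
  have hfrac : ∀ b, ∃ ρ, ∃ σ ∉ P.comap (Ideal.Quotient.mk I), b * φ σ = φ ρ := by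
    intro b
    obtain ⟨⟨a, ⟨c, hc⟩⟩, hac⟩ := IsLocalization.surj P.primeCompl b
    obtain ⟨c, rfl⟩ := Ideal.Quotient.mk_surjective c
    obtain ⟨a, rfl⟩ := Ideal.Quotient.mk_surjective a
    exact ⟨a, c, hc, hac⟩
  have hmem : ∀ a, φ a ∈ IsLocalRing.maximalIdeal (Localization.AtPrime P) →
      a ∈ P.comap (Ideal.Quotient.mk I) := fun a ha =>
    (IsLocalization.AtPrime.to_map_mem_maximal_iff _ P _).1 ha
  obtain ⟨ρ₁, σ₁, hσ₁, e₁⟩ := hfrac r₁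
  obtain ⟨ρ₂, σ₂, hσ₂, e₂⟩ := hfrac r₂
  have d₁ : ∀ x, φ ρ₁ ∣ x ↔ r₁ ∣ x := fun x => by rw [← e₁]; exact (hunit _ hσ₁).mul_right_dvd
  refine ⟨ρ₁, hmem _ (e₁ ▸ Ideal.mul_mem_right _ _ hr₁), ρ₂,
    hmem _ (e₂ ▸ Ideal.mul_mem_right _ _ hr₂), ?_, ?_⟩
  · intro a ha
    refine hker a (h₁ _ ?_)
    have := hkerI _ ha
    rw [map_mul, ← e₁] at this
    refine (hunit _ hσ₁).mul_right_eq_zero.1 ?_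
    linear_combination this
  · intro a ha
    obtain ⟨i, hi, c, hc, hic⟩ := Submodule.mem_sup.1 ha
    obtain ⟨c, rfl⟩ := Ideal.mem_span_singleton'.1 hc
    have hdvd : φ ρ₁ ∣ φ a := by
      rw [d₁]
      refine h₂ _ ?_
      have h3 : r₁ ∣ φ σ₂ * (r₂ * φ a) := by
        rw [← d₁]
        have := congrArg φ hic
        rw [map_add, hkerI i hi, map_mul, map_mul, ← e₂] at this
        exact ⟨φ c, by linear_combination -this⟩
      exact ((hunit _ hσ₂).dvd_mul_left).1 h3
    obtain ⟨b, hb⟩ := hdvd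
    obtain ⟨d, σ, hσ, hd⟩ := hfrac b
    obtain ⟨u, hu, hu'⟩ := hker (σ * a - ρ₁ * d) (by
      rw [map_sub, map_mul, map_mul, ← hd, hb]; ring)
    refine ⟨u * σ, fun hh => (Ideal.IsPrime.mem_or_mem inferInstance hh).elim hu hσ, ?_⟩
    have : u * σ * a = u * (σ * a - ρ₁ * d) + (u * d) * ρ₁ := by ring
    rw [this]
    exact Ideal.add_mem _ (Ideal.mem_sup_left hu')
      (Ideal.mem_sup_right (Ideal.mem_span_singleton'.2 ⟨_, rfl⟩))

/-- If the maximal ideal of a point annihilates a nonzero element `f` of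
`R ⧸ (I ⊔ J)`, then the pair `(f, 0)` of functions on the two pieces spans a
submodule of finite length of `(R ⧸ I × R ⧸ J) ⧸ (R ⧸ (I ⊓ J))`, which bounds the depth of the
union at that point by one. The elements `g` and `h` witness that no component of either piece is
contained in the other one. -/
theorem localDepth_lt_two_of_socle {I J : Ideal R} (P : Ideal (R ⧸ (I ⊓ J))) [P.IsPrime] {f : R}
    (hf : f ∉ I ⊔ J) (hmax : (P.comap (Ideal.Quotient.mk (I ⊓ J))).IsMaximal)
    (hPf : ∀ r ∈ P.comap (Ideal.Quotient.mk (I ⊓ J)), r * f ∈ I ⊔ J)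
    {g h : R} (hgJ : g ∈ J) (hg : RegularModulo I g) (hhI : h ∈ I) (hh : RegularModulo J h) :
    localDepth (Localization.AtPrime P) < 2 := by
  by_contra! hdepth
  obtain ⟨ρ₁, hρ₁, ρ₂, hρ₂, h₁, h₂⟩ := exists_regular_pair_of_two_le_localDepth_quotient P hdepth
  set p := P.comap (Ideal.Quotient.mk (I ⊓ J))
  obtain ⟨u₁, hu₁, v₁, hv₁, e₁⟩ := Submodule.mem_sup.1 (hPf ρ₁ hρ₁)
  obtain ⟨u₂, hu₂, v₂, hv₂, e₂⟩ := Submodule.mem_sup.1 (hPf ρ₂ hρ₂)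
  -- `v₁` and `v₂` represent `ρ₁ • (f, 0)` and `ρ₂ • (f, 0)`
  have hsyz : ρ₂ * v₁ - ρ₁ * v₂ ∈ I ⊓ J := by
    refine ⟨?_, J.sub_mem (J.mul_mem_left _ hv₁) (J.mul_mem_left _ hv₂)⟩
    have : ρ₂ * v₁ - ρ₁ * v₂ = ρ₁ * u₂ - ρ₂ * u₁ := by linear_combination ρ₂ * e₁ - ρ₁ * e₂
    rw [this]
    exact I.sub_mem (I.mul_mem_left _ hu₂) (I.mul_mem_left _ hu₁)
  obtain ⟨u, hu, hu'⟩ := h₂ v₁ (by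
    have : ρ₂ * v₁ = (ρ₂ * v₁ - ρ₁ * v₂) + v₂ * ρ₁ := by ring
    rw [this]
    exact Ideal.add_mem _ (Ideal.mem_sup_left hsyz)
      (Ideal.mem_sup_right (Ideal.mem_span_singleton'.2 ⟨_, rfl⟩)))
  obtain ⟨i, hi, b, hb, hib⟩ := Submodule.mem_sup.1 hu'
  obtain ⟨b, rfl⟩ := Ideal.mem_span_singleton'.1 hb
  -- `ρ₁` annihilates `u • (f, 0) - b`; multiply by `g` or `h` to land in the union
  have hA : ρ₁ * (g * (u * f - b)) ∈ I ⊓ J := by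
    refine ⟨?_, J.mul_mem_left _ (J.mul_mem_right _ hgJ)⟩
    have : ρ₁ * (g * (u * f - b)) = g * (u * u₁ + i) := by
      linear_combination (-g * u) * e₁ + (-g) * hib
    rw [this]
    exact I.mul_mem_left _ (I.add_mem (I.mul_mem_left _ hu₁) hi.1)
  have hB : ρ₁ * (h * b) ∈ I ⊓ J := by
    refine ⟨I.mul_mem_left _ (I.mul_mem_right _ hhI), ?_⟩
    have : ρ₁ * (h * b) = h * (u * v₁ - i) := by linear_combination h * hib
    rw [this]
    exact J.mul_mem_left _ (J.sub_mem (J.mul_mem_left _ hv₁) hi.2)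
  obtain ⟨w, hw, hwA⟩ := h₁ _ hA
  obtain ⟨z, hz, hzB⟩ := h₁ _ hB
  have hA' : w * (u * f - b) ∈ I := hg _ (by
    have : g * (w * (u * f - b)) = w * (g * (u * f - b)) := by ring
    rw [this]; exact hwA.1)
  have hB' : z * b ∈ J := hh _ (by
    have : h * (z * b) = z * (h * b) := by ring
    rw [this]; exact hzB.2)
  have hp : p.IsPrime := hmax.isPrime
  have hc : z * w * u ∉ p := fun hc =>
    (hp.mem_or_mem hc).elim (fun hc => (hp.mem_or_mem hc).elim hz hw) hu
  obtain ⟨y, m, hm, hym⟩ := hmax.exists_inv hc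
  have hcf : z * w * u * f ∈ I ⊔ J := by
    have : z * w * u * f = z * (w * (u * f - b)) + w * (z * b) := by ring
    rw [this]
    exact Ideal.add_mem _ (Ideal.mem_sup_left (I.mul_mem_left _ hA'))
      (Ideal.mem_sup_right (J.mul_mem_left _ hB'))
  apply hf
  have : f = y * (z * w * u * f) + m * f := by linear_combination -f * hym
  rw [this]
  exact Ideal.add_mem _ (Ideal.mul_mem_left _ _ hcf) (hPf m hm)

/-- Prime ideals of `R ⧸ I` have smaller height than their preimages when every prime ideal
containing `I` has height at least `k`. -/
theorem height_add_le_height_comap {I : Ideal R} {k : ℕ∞}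
    (hk : ∀ p : Ideal R, p.IsPrime → I ≤ p → k ≤ p.height) (P : Ideal (R ⧸ I)) [hP : P.IsPrime] :
    P.height + k ≤ (P.comap (Ideal.Quotient.mk I)).height := by
  have key : ∀ (n : ℕ) (Q : PrimeSpectrum (R ⧸ I)), (n : ℕ∞) ≤ Order.height Q →
      (n : ℕ∞) + k ≤ (Q.asIdeal.comap (Ideal.Quotient.mk I)).height := by
    intro n
    induction n with
    | zero =>
      intro Q _
      rw [Nat.cast_zero, zero_add]
      refine hk _ inferInstance fun a ha => ?_
      simp [Ideal.mem_comap, Ideal.Quotient.eq_zero_iff_mem.2 ha]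
    | succ n ih =>
      intro Q hQ
      obtain ⟨Q', hlt, hQ'⟩ : ∃ Q' < Q, (n : ℕ∞) ≤ Order.height Q' := by
        by_contra! hcon
        have := Order.height_le_coe_iff.2 hcon
        exact absurd (Nat.cast_le.1 (hQ.trans this)) (by simp)
      have hlt' : Q'.asIdeal.comap (Ideal.Quotient.mk I) <
          Q.asIdeal.comap (Ideal.Quotient.mk I) := by
        exact (Ideal.orderEmbeddingOfSurjective _ Ideal.Quotient.mk_surjective).strictMono hlt
      have h1 := Ideal.height_add_one_le_of_lt_of_isPrime hlt'
      refine le_trans ?_ h1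
      rw [Nat.cast_succ, add_right_comm]
      gcongr
      exact ih Q' hQ'
  rw [PrimeSpectrum.height_eq_orderHeight ⟨P, hP⟩]
  rcases eq_or_ne (Order.height (⟨P, hP⟩ : PrimeSpectrum (R ⧸ I))) ⊤ with htop | hne
  · have : (P.comap (Ideal.Quotient.mk I)).height = ⊤ := by
      rw [ENat.eq_top_iff_forall_ge]
      intro n
      exact le_self_add.trans (key n ⟨P, hP⟩ (htop ▸ le_top))
    rw [this]; exact le_top
  · obtain ⟨n, hn⟩ := ENat.ne_top_iff_exists.1 hne
    rw [← hn]
    exact key n ⟨P, hP⟩ hn.le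

end Depth

/-! ### Submodules of small support -/

section Support

variable {R : Type*} [CommRing R]

theorem exists_lt_lt_of_two_le_height {I q₀ q₁ : Ideal R} [q₀.IsPrime] [q₁.IsPrime]
    (hI : I ≤ q₀) (h₀₁ : q₀ < q₁) (P : Ideal (R ⧸ I)) [hP : P.IsPrime]
    (h₁ : q₁ < P.comap (Ideal.Quotient.mk I)) : 2 ≤ P.height := by
  have hmk := Ideal.Quotient.mk_surjective (I := I)
  have hcm : ∀ q : Ideal R, I ≤ q →
      (q.map (Ideal.Quotient.mk I)).comap (Ideal.Quotient.mk I) = q := fun q hq => by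
    rw [Ideal.comap_map_of_surjective _ hmk, ← RingHom.ker_eq_comap_bot, Ideal.mk_ker,
      sup_eq_left.2 hq]
  have p₀ : (q₀.map (Ideal.Quotient.mk I)).IsPrime :=
    Ideal.map_isPrime_of_surjective hmk (by rwa [Ideal.mk_ker])
  have p₁ : (q₁.map (Ideal.Quotient.mk I)).IsPrime :=
    Ideal.map_isPrime_of_surjective hmk (by rw [Ideal.mk_ker]; exact hI.trans h₀₁.le)
  have hlt : ∀ Q Q' : Ideal (R ⧸ I), Q.comap (Ideal.Quotient.mk I) < Q'.comap (Ideal.Quotient.mk I)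
      → Q < Q' := fun Q Q' h =>
    (Ideal.orderEmbeddingOfSurjective _ hmk).lt_iff_lt.1 h
  have h2 : 1 < Order.height (⟨P, hP⟩ : PrimeSpectrum (R ⧸ I)) := by
    rw [Order.one_lt_height_iff]
    refine ⟨⟨_, p₁⟩, ⟨_, p₀⟩, hlt _ _ ?_, hlt _ _ ?_⟩
    · change Ideal.comap _ (Ideal.map _ q₀) < Ideal.comap _ (Ideal.map _ q₁)
      rwa [hcm _ hI, hcm _ (hI.trans h₀₁.le)]
    · change Ideal.comap _ (Ideal.map _ q₁) < _
      rwa [hcm _ (hI.trans h₀₁.le)]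
  rw [PrimeSpectrum.height_eq_orderHeight ⟨P, hP⟩]
  exact Order.add_one_le_of_lt h2

/-- A nonzero ideal of `R ⧸ W` with zero-dimensional support contains a nonzero element whose
annihilator is a maximal ideal. -/
theorem exists_isMaximal_annihilator [IsNoetherianRing R] {W : Ideal R} {J : Ideal (R ⧸ W)}
    (hJ : J ≠ ⊥) (hdim : Module.supportDim (R ⧸ W) J ≤ 0) :
    ∃ f ∉ W, ∃ p : Ideal R, p.IsMaximal ∧ ∀ r, r ∈ p ↔ r * f ∈ W := by
  obtain ⟨x, hxJ, hx⟩ := Submodule.exists_mem_ne_zero_of_ne_bot hJ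
  obtain ⟨m, hm, -⟩ := exists_le_isAssociatedPrime_of_isNoetherianRing (R ⧸ W) (⟨x, hxJ⟩ : J)
    (fun h => hx (congrArg Subtype.val h))
  obtain ⟨hmp, ⟨y, hyJ⟩, hy⟩ := isAssociatedPrime_iff.1 hm
  have hmem : ∀ a, a ∈ m ↔ a * y = 0 := by
    intro a
    rw [hy, Submodule.mem_colon_singleton, Submodule.mem_bot]
    exact Subtype.ext_iff
  have hann : Module.annihilator (R ⧸ W) J ≤ m := by
    intro a ha
    rw [hmem]
    exact congrArg Subtype.val (Module.mem_annihilator.1 ha ⟨y, hyJ⟩)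
  have hmax : m.IsMaximal := by
    obtain ⟨m', hm', hle⟩ := m.exists_le_maximal hmp.ne_top
    rcases hle.eq_or_lt with rfl | hlt
    · exact hm'
    · have hmem' : ∀ q : Ideal (R ⧸ W), (hq : q.IsPrime) → m ≤ q →
          (⟨q, hq⟩ : PrimeSpectrum (R ⧸ W)) ∈ Module.support (R ⧸ W) J := fun q hq hle =>
        Module.mem_support_iff_of_finite.2 (hann.trans hle)
      have : 0 < Module.supportDim (R ⧸ W) J := Order.krullDim_pos_iff.2
        ⟨⟨_, hmem' m hmp le_rfl⟩, ⟨_, hmem' m' hm'.isPrime hle⟩, hlt⟩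
      exact absurd hdim this.not_ge
  obtain ⟨f, rfl⟩ := Ideal.Quotient.mk_surjective y
  refine ⟨f, fun hf => ?_, m.comap (Ideal.Quotient.mk W),
    Ideal.comap_isMaximal_of_surjective _ Ideal.Quotient.mk_surjective, fun r => ?_⟩
  · apply hmp.ne_top
    rw [Ideal.eq_top_iff_one, hmem, Ideal.Quotient.eq_zero_iff_mem.2 hf, mul_zero]
  · rw [Ideal.mem_comap, hmem, ← map_mul, Ideal.Quotient.eq_zero_iff_mem]

/-- On a pure one-dimensional scheme, a function with zero-dimensional zero locus is regular. -/
theorem RegularModulo.of_isPureRing [IsNoetherianRing R] {W : Ideal R} (hpure : IsPureRing (R ⧸ W))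
    (hdim : ringKrullDim (R ⧸ W) = 1) {s : R}
    (hs : ∀ p : Ideal R, p.IsPrime → W ≤ p → s ∈ p → p.IsMaximal) : RegularModulo W s := by
  intro f hsf
  by_contra hf
  set J : Ideal (R ⧸ W) := Ideal.span {Ideal.Quotient.mk W f} with hJdef
  have hJ : J ≠ ⊥ := by
    rw [Ne, hJdef, Ideal.span_singleton_eq_bot, Ideal.Quotient.eq_zero_iff_mem]
    exact hf
  have h1 : 1 ≤ Module.supportDim (R ⧸ W) J := (hdim ▸ hpure J hJ).ge
  obtain ⟨⟨q, hq⟩, ⟨q', hq'⟩, hlt⟩ := Order.one_le_krullDim_iff.1 h1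
  have hsann : Ideal.Quotient.mk W s ∈ Module.annihilator (R ⧸ W) J := by
    rw [Module.mem_annihilator]
    rintro ⟨y, hy⟩
    obtain ⟨a, rfl⟩ := Ideal.mem_span_singleton'.1 hy
    refine Subtype.ext ?_
    change Ideal.Quotient.mk W s * (a * Ideal.Quotient.mk W f) = 0
    rw [mul_left_comm, ← map_mul, Ideal.Quotient.eq_zero_iff_mem.2 hsf, mul_zero]
  have hmax : (q.asIdeal.comap (Ideal.Quotient.mk W)).IsMaximal := by
    refine hs _ inferInstance (fun a ha => ?_) (Module.mem_support_iff_of_finite.1 hq hsann)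
    simp [Ideal.mem_comap, Ideal.Quotient.eq_zero_iff_mem.2 ha]
  have hlt' : q.asIdeal.comap (Ideal.Quotient.mk W) < q'.asIdeal.comap (Ideal.Quotient.mk W) :=
    (Ideal.orderEmbeddingOfSurjective _ Ideal.Quotient.mk_surjective).strictMono hlt
  exact hlt'.ne (hmax.eq_of_le (Ideal.IsPrime.ne_top inferInstance) hlt'.le)

end Support

/-! ### Coordinate subspaces of affine space -/

section CoordSubspace

theorem sub_aeval_mem {K : Ideal CoordRing} {φ : Fin 4 → CoordRing}
    (h : ∀ i, X i - φ i ∈ K) (f : CoordRing) : f - aeval φ f ∈ K := by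
  have : (Ideal.Quotient.mkₐ ℂ K) = (Ideal.Quotient.mkₐ ℂ K).comp (aeval φ) := by
    ext i
    simpa using! Ideal.Quotient.eq.2 (h i)
  have h2 := DFunLike.congr_fun this f
  exact Ideal.Quotient.eq.1 h2

/-- The ideal of the affine subspace `x_i = v i`, `i ∈ S`, defined as the kernel of the
substitution of these values, which makes it prime. -/
noncomputable def coordSubspaceIdeal (v : Fin 4 → ℂ) (S : Finset (Fin 4)) : Ideal CoordRing :=
  RingHom.ker (aeval (fun i => if i ∈ S then C (v i) else X i) : CoordRing →ₐ[ℂ] CoordRing)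

instance (v : Fin 4 → ℂ) (S : Finset (Fin 4)) : (coordSubspaceIdeal v S).IsPrime :=
  RingHom.ker_isPrime _

theorem X_sub_C_mem_coordSubspaceIdeal {v : Fin 4 → ℂ} {S : Finset (Fin 4)} {i : Fin 4}
    (hi : i ∈ S) : X i - C (v i) ∈ coordSubspaceIdeal v S := by
  simp [coordSubspaceIdeal, RingHom.mem_ker, hi, algebraMap_eq]

theorem coordSubspaceIdeal_le_iff {v : Fin 4 → ℂ} {S : Finset (Fin 4)} {K : Ideal CoordRing} :
    coordSubspaceIdeal v S ≤ K ↔ ∀ i ∈ S, X i - C (v i) ∈ K := by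
  refine ⟨fun h i hi => h (X_sub_C_mem_coordSubspaceIdeal hi), fun h f hf => ?_⟩
  have := sub_aeval_mem (K := K) (φ := fun i => if i ∈ S then C (v i) else X i) (fun i => by
    split_ifs with hi
    · exact h i hi
    · simp) f
  rwa [(RingHom.mem_ker).1 hf, sub_zero] at this

theorem coordSubspaceIdeal_lt_insert (v : Fin 4 → ℂ) {S : Finset (Fin 4)} {a : Fin 4}
    (ha : a ∉ S) : coordSubspaceIdeal v S < coordSubspaceIdeal v (insert a S) := by
  refine lt_of_le_of_ne (coordSubspaceIdeal_le_iff.2 fun i hi =>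
    X_sub_C_mem_coordSubspaceIdeal (Finset.mem_insert_of_mem hi)) fun heq => ?_
  have h1 : X a - C (v a) ∈ coordSubspaceIdeal v S :=
    heq ▸ X_sub_C_mem_coordSubspaceIdeal (Finset.mem_insert_self a S)
  have h2 : (X a - C (v a) : CoordRing) = 0 := by
    simpa [coordSubspaceIdeal, RingHom.mem_ker, ha, algebraMap_eq] using h1
  have h3 := congrArg (eval fun _ => v a + 1) h2
  simp at h3

theorem card_le_height_coordSubspaceIdeal (v : Fin 4 → ℂ) (S : Finset (Fin 4)) :
    (S.card : ℕ∞) ≤ (coordSubspaceIdeal v S).height := by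
  induction S using Finset.induction_on with
  | empty => simp
  | insert a S ha ih =>
    rw [Finset.card_insert_of_notMem ha, Nat.cast_succ]
    exact le_trans (by gcongr)
      (Ideal.height_add_one_le_of_lt_of_isPrime (coordSubspaceIdeal_lt_insert v ha))

theorem height_le_four (p : Ideal CoordRing) [p.IsPrime] : p.height ≤ 4 := by
  have h := Ideal.height_le_ringKrullDim_of_isPrime (I := p)
  rw [MvPolynomial.ringKrullDim_of_isNoetherianRing, ringKrullDim_eq_zero_of_field] at h
  have h4 : (p.height : WithBot ℕ∞) ≤ ((4 : ℕ∞) : WithBot ℕ∞) := by simpa using! h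
  exact WithBot.coe_le_coe.1 h4

theorem isMaximal_of_X_sub_C_mem {p : Ideal CoordRing} (hp : p ≠ ⊤) (v : Fin 4 → ℂ)
    (h : ∀ i, X i - C (v i) ∈ p) : p.IsMaximal := by
  have hmax : (RingHom.ker (eval v)).IsMaximal :=
    RingHom.ker_isMaximal_of_surjective _ fun z => ⟨C z, by simp⟩
  have hle : RingHom.ker (eval v) ≤ p := by
    intro f hf
    have := sub_aeval_mem (φ := fun i => C (v i)) h f
    have h2 : aeval (fun i => (C (v i) : CoordRing)) f = C (eval v f) := by
      have : (aeval (fun i => (C (v i) : CoordRing)) : CoordRing →ₐ[ℂ] CoordRing) =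
          (Algebra.ofId ℂ CoordRing).comp (aeval v) := by
        ext i; simp [Algebra.ofId_apply, algebraMap_eq]
      rw [this]
      simp [Algebra.ofId_apply, algebraMap_eq]
    rw [h2, (RingHom.mem_ker).1 hf, map_zero, sub_zero] at this
    exact this
  exact hmax.eq_of_le hp hle ▸ hmax

theorem exists_X_sub_C_mem {p : Ideal CoordRing} (hp : p.IsMaximal) :
    ∃ v : Fin 4 → ℂ, ∀ i, X i - C (v i) ∈ p := by
  obtain ⟨v, rfl⟩ := MvPolynomial.eq_vanishingIdeal_singleton_of_isMaximal ℂ hp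
  refine ⟨v, fun i => ?_⟩
  rw [mem_vanishingIdeal_singleton_iff]
  simp

/-- The ideal of the coordinate plane `x_c = x_d = 0`. -/
noncomputable def planeIdeal (c d : Fin 4) : Ideal CoordRing := coordSubspaceIdeal 0 {c, d}

instance (c d : Fin 4) : (planeIdeal c d).IsPrime := by unfold planeIdeal; infer_instance

theorem planeIdeal_le_iff {c d : Fin 4} {K : Ideal CoordRing} :
    planeIdeal c d ≤ K ↔ X c ∈ K ∧ X d ∈ K := by
  simp [planeIdeal, coordSubspaceIdeal_le_iff]

theorem two_le_height_planeIdeal {c d : Fin 4} (h : c ≠ d) : 2 ≤ (planeIdeal c d).height := by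
  have := card_le_height_coordSubspaceIdeal 0 {c, d}
  rwa [Finset.card_pair h] at this

/-- The linear form `x₁ + x₂ + x₃ + x₄ - z`. -/
noncomputable def sumForm (z : ℂ) : CoordRing := ∑ i, X i - C z

/-- The linear form `∑ k x_{k+1} - z`. Together with `sumForm` it gives
coordinates on every coordinate plane, because its coefficients are distinct. -/
noncomputable def weightedForm (z : ℂ) : CoordRing := ∑ i : Fin 4, C (i.val : ℂ) * X i - C z

theorem exists_sumForm_mem {p : Ideal CoordRing} (hp : p.IsMaximal) : ∃ z, sumForm z ∈ p := by
  obtain ⟨v, hv⟩ := exists_X_sub_C_mem hp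
  refine ⟨∑ i, v i, ?_⟩
  have : sumForm (∑ i, v i) = ∑ i, (X i - C (v i)) := by
    simp [sumForm, Finset.sum_sub_distrib, map_sum]
  rw [this]
  exact Ideal.sum_mem _ fun i _ => hv i

theorem exists_weightedForm_mem {p : Ideal CoordRing} (hp : p.IsMaximal) :
    ∃ z, weightedForm z ∈ p := by
  obtain ⟨v, hv⟩ := exists_X_sub_C_mem hp
  refine ⟨∑ i : Fin 4, (i.val : ℂ) * v i, ?_⟩
  have : weightedForm (∑ i : Fin 4, (i.val : ℂ) * v i) =
      ∑ i : Fin 4, C (i.val : ℂ) * (X i - C (v i)) := by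
    simp only [weightedForm, map_sum, map_mul, mul_sub, Finset.sum_sub_distrib]
  rw [this]
  exact Ideal.sum_mem _ fun i _ => Ideal.mul_mem_left _ _ (hv i)

theorem regularModulo_planeIdeal_sumForm {c d : Fin 4} (z : ℂ) :
    RegularModulo (planeIdeal c d) (sumForm z) := by
  refine RegularModulo.of_isPrime inferInstance fun hmem => ?_
  -- there is a further coordinate `a`; evaluate at the point of its axis with coordinate `z + 1`
  obtain ⟨a, hac, had⟩ : ∃ a : Fin 4, a ≠ c ∧ a ≠ d := by clear hmem; revert c d; decide
  have hle : planeIdeal c d ≤ RingHom.ker (eval (Pi.single a (z + 1))) :=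
    planeIdeal_le_iff.2 ⟨by simp [RingHom.mem_ker, hac.symm], by simp [RingHom.mem_ker, had.symm]⟩
  have := (RingHom.mem_ker).1 (hle hmem)
  simp [sumForm] at this

theorem regularModulo_planeIdeal_sup_weightedForm {c d : Fin 4} (hcd : c ≠ d) (z w : ℂ) :
    RegularModulo (planeIdeal c d ⊔ Ideal.span {sumForm z}) (weightedForm w) := by
  obtain ⟨a, b, hab, hac, had, hbc, hbd, huniv⟩ : ∃ a b : Fin 4, a ≠ b ∧ a ≠ c ∧ a ≠ d ∧ b ≠ c ∧
      b ≠ d ∧ (Finset.univ : Finset (Fin 4)) = {a, b, c, d} := by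
    revert c d; decide
  have hsum : ∀ g : Fin 4 → CoordRing, ∑ i, g i = g a + g b + g c + g d := by
    intro g
    rw [huniv, Finset.sum_insert (by simp [hab, hac, had]), Finset.sum_insert (by simp [hbc, hbd]),
      Finset.sum_pair hcd]
    ring
  -- the line cut out on the plane is parametrized by `x_a`
  let φ : Fin 4 → CoordRing := fun i => if i = a then X a else if i = b then C z - X a else 0
  have φa : φ a = X a := by simp [φ]
  have φb : φ b = C z - X a := by simp [φ, hab.symm]
  have φc : φ c = 0 := by simp [φ, hac.symm, hbc.symm]
  have φd : φ d = 0 := by simp [φ, had.symm, hbd.symm]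
  have hle : planeIdeal c d ⊔ Ideal.span {sumForm z} ≤
      RingHom.ker (aeval φ : CoordRing →ₐ[ℂ] CoordRing) := by
    refine sup_le
      (planeIdeal_le_iff.2 ⟨by simp [RingHom.mem_ker, φc], by simp [RingHom.mem_ker, φd]⟩)
      ((Ideal.span_singleton_le_iff_mem _).2 ?_)
    simp [RingHom.mem_ker, sumForm, hsum, φa, φb, φc, φd, algebraMap_eq]
  have hX : ∀ i, X i - φ i ∈ planeIdeal c d ⊔ Ideal.span {sumForm z} := by
    have hc : X c ∈ planeIdeal c d := (planeIdeal_le_iff.1 le_rfl).1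
    have hd : X d ∈ planeIdeal c d := (planeIdeal_le_iff.1 le_rfl).2
    intro i
    have hi : i ∈ ({a, b, c, d} : Finset (Fin 4)) := huniv ▸ Finset.mem_univ i
    simp only [Finset.mem_insert, Finset.mem_singleton] at hi
    rcases hi with rfl | rfl | rfl | rfl
    · rw [φa, sub_self]; exact zero_mem _
    · have : X i - φ i = (-X c - X d) + sumForm z := by
        rw [φb, sumForm, hsum]; ring
      rw [this]
      exact Ideal.add_mem _ (Ideal.mem_sup_left (sub_mem (neg_mem hc) hd))
        (Ideal.mem_sup_right (Ideal.mem_span_singleton_self _))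
    · rw [φc, sub_zero]; exact Ideal.mem_sup_left hc
    · rw [φd, sub_zero]; exact Ideal.mem_sup_left hd
  intro f hf
  have h1 : aeval φ (weightedForm w) * aeval φ f = 0 := by
    rw [← map_mul]; exact hle hf
  have h2 : aeval φ (weightedForm w) ≠ 0 := by
    intro h0
    have hne : (a.val : ℂ) - b.val ≠ 0 := by
      rw [sub_ne_zero, Ne, Nat.cast_inj, Fin.val_inj]; exact hab
    have h3 := congrArg (eval fun _ => (1 + w - b.val * z) / ((a.val : ℂ) - b.val)) h0
    simp only [weightedForm, hsum, map_sub, map_add, map_mul, aeval_X, aeval_C, algebraMap_eq, φa,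
      φb, φc, φd, eval_X, eval_C, map_zero] at h3
    field_simp at h3
    ring_nf at h3
    have : (a.val : ℂ) - b.val = 0 := by linear_combination h3
    exact hne this
  have h3 := sub_aeval_mem hX f
  rwa [(mul_eq_zero.1 h1).resolve_left h2, sub_zero] at h3

end CoordSubspace

/-! ### Monomial ideals of lower sets of exponents -/

section Monomial

theorem mem_monomialIdeal {π : Set (Fin 4 →₀ ℕ)} (hπ : IsLowerSet π) {f : CoordRing} :
    f ∈ monomialIdeal π ↔ ∀ i ∈ f.support, i ∉ π := by
  rw [monomialIdeal, mem_ideal_span_monomial_image]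
  exact ⟨fun h i hi hπi => (h i hi).elim fun j hj => hj.1 (hπ hj.2 hπi),
    fun h i hi => ⟨i, h i hi, le_rfl⟩⟩

theorem monomial_mem_monomialIdeal {π : Set (Fin 4 →₀ ℕ)} {i : Fin 4 →₀ ℕ} (hi : i ∉ π) :
    (monomial i (1 : ℂ) : CoordRing) ∈ monomialIdeal π :=
  Ideal.subset_span ⟨i, hi, rfl⟩

theorem monomialIdeal_union {π ρ : Set (Fin 4 →₀ ℕ)} (hπ : IsLowerSet π) (hρ : IsLowerSet ρ) :
    monomialIdeal (π ∪ ρ) = monomialIdeal π ⊓ monomialIdeal ρ := by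
  ext f
  rw [Ideal.mem_inf, mem_monomialIdeal (hπ.union hρ), mem_monomialIdeal hπ, mem_monomialIdeal hρ]
  simp only [Set.mem_union, not_or, ← forall₂_and]

theorem monomialIdeal_empty : monomialIdeal ∅ = ⊤ :=
  (Ideal.eq_top_iff_one _).2 ((mem_monomialIdeal isLowerSet_empty).2 fun _ _ => id)

theorem isLowerSet_cylinder (c d : Fin 4) (μ : YoungDiagram) : IsLowerSet (cylinder c d μ) :=
  fun _ _ hij hi => μ.up_left_mem (hij c) (hij d) hi

theorem planeIdeal_eq_monomialIdeal (c d : Fin 4) :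
    planeIdeal c d = monomialIdeal {j | j c = 0 ∧ j d = 0} := by
  have hlow : IsLowerSet {j : Fin 4 →₀ ℕ | j c = 0 ∧ j d = 0} := fun i j hij hi =>
    ⟨Nat.le_zero.1 (hi.1 ▸ hij c), Nat.le_zero.1 (hi.2 ▸ hij d)⟩
  refine le_antisymm (planeIdeal_le_iff.2 ⟨?_, ?_⟩) (Ideal.span_le.2 ?_)
  · exact monomial_mem_monomialIdeal (by simp)
  · exact monomial_mem_monomialIdeal (by simp)
  · rintro _ ⟨i, hi, rfl⟩
    have key : ∀ k, i k ≠ 0 → X k ∈ planeIdeal c d → monomial i (1 : ℂ) ∈ planeIdeal c d := by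
      intro k hk hX
      refine Ideal.mem_of_dvd _ ?_ hX
      rw [X_dvd_monomial]
      exact Or.inr hk
    by_cases hc : i c = 0
    · exact key d (fun hd => hi ⟨hc, hd⟩) (planeIdeal_le_iff.1 le_rfl).2
    · exact key c hc (planeIdeal_le_iff.1 le_rfl).1

/-- Adjoining to a lower set `π` of exponents one disjoint translate `i + {j | j c = j d = 0}` of a
coordinate quadrant adjoins one step `R ⧸ (x_c, x_d)`, generated by `x^i`, to the filtration. -/
theorem HasCyclicFiltration.adjoin_quadrant {S : Set (Ideal CoordRing)} {π : Set (Fin 4 →₀ ℕ)}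
    (hπ : IsLowerSet π) (h : HasCyclicFiltration S (monomialIdeal π)) {c d : Fin 4}
    (hq : planeIdeal c d ∈ S) {i : Fin 4 →₀ ℕ} (hi : i ∉ π)
    {π' : Set (Fin 4 →₀ ℕ)} (hlow : IsLowerSet π')
    (hπ' : ∀ j, j ∈ π' ↔ j ∈ π ∨ i ≤ j ∧ j c = i c ∧ j d = i d) :
    HasCyclicFiltration S (monomialIdeal π') := by
  have hsup : monomialIdeal π' ⊔ Ideal.span {monomial i (1 : ℂ)} = monomialIdeal π := by
    refine le_antisymm (sup_le ?_ ?_) (Ideal.span_le.2 ?_)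
    · exact Ideal.span_mono (Set.image_mono
        (Set.compl_subset_compl.2 fun j hj => (hπ' j).2 (.inl hj)))
    · exact (Ideal.span_singleton_le_iff_mem _).2 (monomial_mem_monomialIdeal hi)
    · rintro _ ⟨j, hj, rfl⟩
      by_cases hj' : j ∈ π'
      · have hij : i ≤ j := (((hπ' j).1 hj').resolve_left hj).1
        refine Ideal.mem_sup_right (Ideal.mem_span_singleton.2 ?_)
        rw [monomial_dvd_monomial]
        exact ⟨Or.inr hij, one_dvd _⟩
      · exact Ideal.mem_sup_left (monomial_mem_monomialIdeal hj')
  have hplane : IsLowerSet {j : Fin 4 →₀ ℕ | j c = 0 ∧ j d = 0} := fun i j hij hi =>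
    ⟨Nat.le_zero.1 (hi.1 ▸ hij c), Nat.le_zero.1 (hi.2 ▸ hij d)⟩
  refine .step _ (monomial i 1) (planeIdeal c d) hq (fun g => ?_) (hsup ▸ h)
  rw [mem_monomialIdeal hlow, planeIdeal_eq_monomialIdeal, mem_monomialIdeal hplane]
  have hmem : ∀ j, j + i ∈ π' ↔ j c = 0 ∧ j d = 0 := by
    intro j
    have : j + i ∉ π := fun hj => hi (hπ le_add_self hj)
    rw [hπ']
    simp [this]
  constructor
  · intro hg j hj hjc
    refine hg (j + i) ?_ ((hmem j).2 hjc)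
    rw [mem_support_iff, coeff_mul_monomial, mul_one]
    exact mem_support_iff.1 hj
  · intro hg k hk hkπ
    rw [mem_support_iff, coeff_mul_monomial', mul_one] at hk
    split_ifs at hk with hik
    · refine hg (k - i) (mem_support_iff.2 hk) ((hmem _).1 ?_)
      rwa [tsub_add_cancel_of_le hik]
    · exact hk rfl

/-- Adjoining a cylinder to a lower set `π` of exponents adjoins one quadrant for each cell of the
Young diagram, as long as `π` cuts off from the fibre over each cell the complement of a quadrant. -/
theorem HasCyclicFiltration.adjoin_cylinder {S : Set (Ideal CoordRing)} {π : Set (Fin 4 →₀ ℕ)}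
    (hπ : IsLowerSet π) (h : HasCyclicFiltration S (monomialIdeal π)) {c d : Fin 4}
    (μ : YoungDiagram) (hq : μ ≠ ⊥ → planeIdeal c d ∈ S)
    (corner : ℕ × ℕ → Fin 4 →₀ ℕ)
    (hc : ∀ p ∈ μ, corner p c = p.1 ∧ corner p d = p.2)
    (hcorner : ∀ p ∈ μ, ∀ j : Fin 4 →₀ ℕ, j c = p.1 → j d = p.2 → (j ∉ π ↔ corner p ≤ j)) :
    HasCyclicFiltration S (monomialIdeal (π ∪ cylinder c d μ)) := by
  have key : ∀ (n : ℕ) (s : Finset (ℕ × ℕ)), s.card = n → IsLowerSet (s : Set (ℕ × ℕ)) →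
      s ⊆ μ.cells → HasCyclicFiltration S (monomialIdeal (π ∪ {j | (j c, j d) ∈ s})) := by
    intro n
    induction n with
    | zero =>
      intro s hs _ _
      rw [Finset.card_eq_zero.1 hs]
      simpa using h
    | succ n ih =>
      intro s hs hlow hsub
      have hlowcyl : ∀ t : Finset (ℕ × ℕ), IsLowerSet (t : Set (ℕ × ℕ)) →
          IsLowerSet (π ∪ {j : Fin 4 →₀ ℕ | (j c, j d) ∈ t}) := fun t ht =>
        hπ.union fun i j hij hi => ht (show (j c, j d) ≤ (i c, i d) from ⟨hij c, hij d⟩) hi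
      obtain ⟨p, hp, hmax⟩ := s.exists_maximal (Finset.card_pos.1 (by omega))
      have hpμ : p ∈ μ := hsub hp
      have hlow' : IsLowerSet ((s.erase p : Finset (ℕ × ℕ)) : Set (ℕ × ℕ)) := by
        intro a b hba ha
        have ha' := Finset.mem_erase.1 ha
        refine Finset.mem_erase.2 ⟨?_, hlow hba ha'.2⟩
        rintro rfl
        exact ha'.1 (le_antisymm (hmax ha'.2 hba) hba)
      have ih' := ih (s.erase p) (by rw [Finset.card_erase_of_mem hp]; omega) hlow'
        ((Finset.erase_subset _ _).trans hsub)
      refine ih'.adjoin_quadrant (hlowcyl _ hlow') (hq ?_) (i := corner p) ?_ (hlowcyl _ hlow) ?_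
      · rintro rfl; exact YoungDiagram.notMem_bot p hpμ
      · rintro (hcor | hcor)
        · exact (hcorner p hpμ (corner p) (hc p hpμ).1 (hc p hpμ).2).2 le_rfl hcor
        · simp [(hc p hpμ).1, (hc p hpμ).2] at hcor
      · intro j
        rw [(hc p hpμ).1, (hc p hpμ).2]
        simp only [Set.mem_union, Set.mem_ofPred_eq, Finset.mem_erase, Ne, Prod.ext_iff]
        by_cases hj : j c = p.1 ∧ j d = p.2
        · have : (j c, j d) ∈ s := by rw [hj.1, hj.2]; exact hp
          have := hcorner p hpμ j hj.1 hj.2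
          tauto
        · tauto
  exact key _ μ.cells rfl μ.isLowerSet subset_rfl

end Monomial

/-! ### The two halves of the union of planes -/

/-- The ideals of the plane `x_c = x_d = 0`, if `μ` is not empty; no ideals otherwise. -/
def supportPlanes (c d : Fin 4) (μ : YoungDiagram) : Set (Ideal CoordRing) :=
  {q | μ ≠ ⊥ ∧ q = planeIdeal c d}

theorem finite_supportPlanes (c d : Fin 4) (μ : YoungDiagram) : (supportPlanes c d μ).Finite :=
  (Set.finite_singleton (planeIdeal c d)).subset fun _ hq => hq.2

theorem monomialIdeal_cylinder_le_planeIdeal {c d : Fin 4} {μ : YoungDiagram} (hμ : μ ≠ ⊥) :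
    monomialIdeal (cylinder c d μ) ≤ planeIdeal c d := by
  rw [planeIdeal_eq_monomialIdeal]
  refine Ideal.span_mono (Set.image_mono (Set.compl_subset_compl.2 ?_))
  rintro j ⟨hc, hd⟩
  obtain ⟨⟨a, b⟩, hab⟩ : μ.cells.Nonempty := by
    rw [Finset.nonempty_iff_ne_empty]
    exact fun h => hμ (YoungDiagram.ext h)
  change (j c, j d) ∈ μ
  rw [hc, hd]
  exact μ.up_left_mem (Nat.zero_le a) (Nat.zero_le b) hab

theorem exists_supportPlanes_le {c d : Fin 4} (hcd : c ≠ d) {μ : YoungDiagram}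
    {p : Ideal CoordRing} [hp : p.IsPrime] (h : monomialIdeal (cylinder c d μ) ≤ p) :
    ∃ q ∈ supportPlanes c d μ, q ≤ p := by
  have hμ : μ ≠ ⊥ := by
    rintro rfl
    have : cylinder c d ⊥ = ∅ := Set.eq_empty_of_forall_notMem fun j hj =>
      YoungDiagram.notMem_bot _ hj
    rw [this, monomialIdeal_empty, top_le_iff] at h
    exact hp.ne_top h
  refine ⟨_, ⟨hμ, rfl⟩, planeIdeal_le_iff.2 ⟨?_, ?_⟩⟩
  · refine hp.mem_of_pow_mem (μ.colLen 0) (h ?_)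
    rw [X_pow_eq_monomial]
    refine monomial_mem_monomialIdeal fun hmem => ?_
    have hmem' : (Finsupp.single c (μ.colLen 0) c, Finsupp.single c (μ.colLen 0) d) ∈ μ := hmem
    rw [Finsupp.single_eq_same, Finsupp.single_eq_of_ne hcd.symm,
      YoungDiagram.mem_iff_lt_colLen] at hmem'
    exact lt_irrefl _ hmem'
  · refine hp.mem_of_pow_mem (μ.rowLen 0) (h ?_)
    rw [X_pow_eq_monomial]
    refine monomial_mem_monomialIdeal fun hmem => ?_
    have hmem' : (Finsupp.single d (μ.rowLen 0) c, Finsupp.single d (μ.rowLen 0) d) ∈ μ := hmem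
    rw [Finsupp.single_eq_same, Finsupp.single_eq_of_ne hcd,
      YoungDiagram.mem_iff_lt_rowLen] at hmem'
    exact lt_irrefl _ hmem'

theorem planeIdeal_le_planeIdeal_symm {c d c' d' : Fin 4} (h' : c' ≠ d')
    (h : planeIdeal c' d' ≤ planeIdeal c d) : planeIdeal c d ≤ planeIdeal c' d' := by
  have hX : ∀ k, X k ∈ planeIdeal c d → k = c ∨ k = d := by
    intro k hk
    by_contra! hne
    have hle : planeIdeal c d ≤ RingHom.ker (eval (Pi.single k (1 : ℂ))) :=
      planeIdeal_le_iff.2 ⟨by simp [RingHom.mem_ker, hne.1.symm],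
        by simp [RingHom.mem_ker, hne.2.symm]⟩
    simpa [RingHom.mem_ker] using hle hk
  obtain ⟨h1, h2⟩ := planeIdeal_le_iff.1 h
  obtain ⟨g1, g2⟩ := planeIdeal_le_iff.1 (le_refl (planeIdeal c' d'))
  rcases hX _ h1 with rfl | rfl <;> rcases hX _ h2 with rfl | rfl
  · exact absurd rfl h'
  · exact planeIdeal_le_iff.2 ⟨g1, g2⟩
  · exact planeIdeal_le_iff.2 ⟨g2, g1⟩
  · exact absurd rfl h'

namespace SixPartitions

variable (L : SixPartitions)

/-- The ideal of `Z_{λ₁₂} ∪ Z_{λ₁₃} ∪ Z_{λ₂₃}`, which is supported on the hyperplane `x₄ = 0`. -/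
noncomputable def idealHyperplane : Ideal CoordRing :=
  monomialIdeal L.π12 ⊓ monomialIdeal L.π13 ⊓ monomialIdeal L.π23

/-- The ideal of `Z_{λ₁₄} ∪ Z_{λ₂₄} ∪ Z_{λ₃₄}`, the product of a thickened union of axes in
`ℂ³` with the `x₄`-axis. -/
noncomputable def idealProduct : Ideal CoordRing :=
  monomialIdeal L.π14 ⊓ monomialIdeal L.π24 ⊓ monomialIdeal L.π34

theorem idealW_eq : L.idealW = L.idealHyperplane ⊔ L.idealProduct := rfl

theorem isLowerSet_π12 : IsLowerSet L.π12 := isLowerSet_cylinder _ _ _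
theorem isLowerSet_π13 : IsLowerSet L.π13 := isLowerSet_cylinder _ _ _
theorem isLowerSet_π14 : IsLowerSet L.π14 := isLowerSet_cylinder _ _ _
theorem isLowerSet_π23 : IsLowerSet L.π23 := isLowerSet_cylinder _ _ _
theorem isLowerSet_π24 : IsLowerSet L.π24 := isLowerSet_cylinder _ _ _
theorem isLowerSet_π34 : IsLowerSet L.π34 := isLowerSet_cylinder _ _ _

theorem idealHyperplane_eq : L.idealHyperplane = monomialIdeal (L.π12 ∪ L.π13 ∪ L.π23) := by
  rw [monomialIdeal_union (L.isLowerSet_π12.union L.isLowerSet_π13) L.isLowerSet_π23,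
    monomialIdeal_union L.isLowerSet_π12 L.isLowerSet_π13, idealHyperplane]

theorem idealProduct_eq : L.idealProduct = monomialIdeal (L.π34 ∪ L.π24 ∪ L.π14) := by
  rw [monomialIdeal_union (L.isLowerSet_π34.union L.isLowerSet_π24) L.isLowerSet_π14,
    monomialIdeal_union L.isLowerSet_π34 L.isLowerSet_π24, idealProduct, inf_comm,
    inf_comm (monomialIdeal L.π14), inf_assoc]

theorem idealZ_eq : L.idealZ = L.idealHyperplane ⊓ L.idealProduct := by
  rw [idealHyperplane_eq, idealProduct_eq, ← monomialIdeal_union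
    ((L.isLowerSet_π12.union L.isLowerSet_π13).union L.isLowerSet_π23)
    ((L.isLowerSet_π34.union L.isLowerSet_π24).union L.isLowerSet_π14), idealZ]
  congr 1
  ext i
  simp only [Set.mem_union]
  tauto

/-- The ideals of the irreducible components of `Z_{λ₁₂} ∪ Z_{λ₁₃} ∪ Z_{λ₂₃}`. -/
def planesHyperplane : Set (Ideal CoordRing) :=
  supportPlanes 2 3 L.l12 ∪ supportPlanes 1 3 L.l13 ∪ supportPlanes 0 3 L.l23

/-- The ideals of the irreducible components of `Z_{λ₁₄} ∪ Z_{λ₂₄} ∪ Z_{λ₃₄}`. -/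
def planesProduct : Set (Ideal CoordRing) :=
  supportPlanes 0 1 L.l34 ∪ supportPlanes 0 2 L.l24 ∪ supportPlanes 1 2 L.l14

theorem exists_eq_planeIdeal {q : Ideal CoordRing}
    (hq : q ∈ L.planesHyperplane ∪ L.planesProduct) : ∃ c d, c ≠ d ∧ q = planeIdeal c d := by
  rcases hq with ((⟨-, rfl⟩ | ⟨-, rfl⟩) | ⟨-, rfl⟩) | ((⟨-, rfl⟩ | ⟨-, rfl⟩) | ⟨-, rfl⟩) <;>
  exact ⟨_, _, by decide, rfl⟩

/-- In the fibre over a cell of a cylinder the exponent of `x₄` is fixed, and each of the cylinders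
adjoined before restricts only one of the two free exponents, so that the new part of the fibre is
a quadrant. -/
theorem hasCyclicFiltration_idealHyperplane :
    HasCyclicFiltration L.planesHyperplane L.idealHyperplane := by
  have h0 : HasCyclicFiltration L.planesHyperplane (monomialIdeal ∅) := by
    rw [monomialIdeal_empty]; exact .top
  have h1 : HasCyclicFiltration L.planesHyperplane (monomialIdeal (∅ ∪ L.π12)) := by
    refine h0.adjoin_cylinder isLowerSet_empty L.l12 (fun hμ => .inl (.inl ⟨hμ, rfl⟩))
      (fun p => Finsupp.equivFunOnFinite.symm ![0, 0, p.1, p.2]) (fun p _ => by simp) ?_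
    intro p _ j hc hd
    simp [Finsupp.le_def, Fin.forall_fin_succ, hc, hd]
  rw [Set.empty_union] at h1
  have h2 : HasCyclicFiltration L.planesHyperplane (monomialIdeal (L.π12 ∪ L.π13)) := by
    refine h1.adjoin_cylinder L.isLowerSet_π12 L.l13 (fun hμ => .inl (.inr ⟨hμ, rfl⟩))
      (fun p => Finsupp.equivFunOnFinite.symm ![0, p.1, L.l12.colLen p.2, p.2])
      (fun p _ => by simp) ?_
    intro p _ j hc hd
    simp [Finsupp.le_def, Fin.forall_fin_succ, hc, hd, π12, cylinder,
      YoungDiagram.mem_iff_lt_colLen]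
  rw [idealHyperplane_eq]
  refine h2.adjoin_cylinder (L.isLowerSet_π12.union L.isLowerSet_π13) L.l23
    (fun hμ => .inr ⟨hμ, rfl⟩)
    (fun p => Finsupp.equivFunOnFinite.symm ![p.1, L.l13.colLen p.2, L.l12.colLen p.2, p.2])
    (fun p _ => by simp) ?_
  intro p _ j hc hd
  simp [Finsupp.le_def, Fin.forall_fin_succ, hc, hd, π12, π13, cylinder,
    YoungDiagram.mem_iff_lt_colLen, and_comm]

/-- In the fibre over a cell of a cylinder the exponent of `x₄` is free, and the cylinders adjoined
before all restrict the other free exponent, so that the new part of the fibre is a quadrant. -/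
theorem hasCyclicFiltration_idealProduct :
    HasCyclicFiltration L.planesProduct L.idealProduct := by
  have h0 : HasCyclicFiltration L.planesProduct (monomialIdeal ∅) := by
    rw [monomialIdeal_empty]; exact .top
  have h1 : HasCyclicFiltration L.planesProduct (monomialIdeal (∅ ∪ L.π34)) := by
    refine h0.adjoin_cylinder isLowerSet_empty L.l34 (fun hμ => .inl (.inl ⟨hμ, rfl⟩))
      (fun p => Finsupp.equivFunOnFinite.symm ![p.1, p.2, 0, 0]) (fun p _ => by simp) ?_
    intro p _ j hc hd
    simp [Finsupp.le_def, Fin.forall_fin_succ, hc, hd]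
  rw [Set.empty_union] at h1
  have h2 : HasCyclicFiltration L.planesProduct (monomialIdeal (L.π34 ∪ L.π24)) := by
    refine h1.adjoin_cylinder L.isLowerSet_π34 L.l24 (fun hμ => .inl (.inr ⟨hμ, rfl⟩))
      (fun p => Finsupp.equivFunOnFinite.symm ![p.1, L.l34.rowLen p.1, p.2, 0])
      (fun p _ => by simp) ?_
    intro p _ j hc hd
    simp [Finsupp.le_def, Fin.forall_fin_succ, hc, hd, π34, cylinder,
      YoungDiagram.mem_iff_lt_rowLen]
  rw [idealProduct_eq]
  refine h2.adjoin_cylinder (L.isLowerSet_π34.union L.isLowerSet_π24) L.l14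
    (fun hμ => .inr ⟨hμ, rfl⟩)
    (fun p => Finsupp.equivFunOnFinite.symm
      ![max (L.l34.colLen p.1) (L.l24.colLen p.2), p.1, p.2, 0])
    (fun p _ => by simp) ?_
  intro p _ j hc hd
  simp [Finsupp.le_def, Fin.forall_fin_succ, hc, hd, π34, π24, cylinder,
    YoungDiagram.mem_iff_lt_colLen]

theorem exists_planesHyperplane_le {p : Ideal CoordRing} [hp : p.IsPrime]
    (h : L.idealHyperplane ≤ p) : ∃ q ∈ L.planesHyperplane, q ≤ p := by
  rcases hp.inf_le.1 h with h | h
  · rcases hp.inf_le.1 h with h | h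
    · obtain ⟨q, hq, hqp⟩ := exists_supportPlanes_le (by decide) h
      exact ⟨q, .inl (.inl hq), hqp⟩
    · obtain ⟨q, hq, hqp⟩ := exists_supportPlanes_le (by decide) h
      exact ⟨q, .inl (.inr hq), hqp⟩
  · obtain ⟨q, hq, hqp⟩ := exists_supportPlanes_le (by decide) h
    exact ⟨q, .inr hq, hqp⟩

theorem exists_planesProduct_le {p : Ideal CoordRing} [hp : p.IsPrime]
    (h : L.idealProduct ≤ p) : ∃ q ∈ L.planesProduct, q ≤ p := by
  rcases hp.inf_le.1 h with h | h
  · rcases hp.inf_le.1 h with h | h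
    · obtain ⟨q, hq, hqp⟩ := exists_supportPlanes_le (by decide) h
      exact ⟨q, .inr hq, hqp⟩
    · obtain ⟨q, hq, hqp⟩ := exists_supportPlanes_le (by decide) h
      exact ⟨q, .inl (.inr hq), hqp⟩
  · obtain ⟨q, hq, hqp⟩ := exists_supportPlanes_le (by decide) h
    exact ⟨q, .inl (.inl hq), hqp⟩

theorem exists_planes_le {p : Ideal CoordRing} [hp : p.IsPrime] (h : L.idealZ ≤ p) :
    ∃ q ∈ L.planesHyperplane ∪ L.planesProduct, q ≤ p := by
  rw [idealZ_eq] at h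
  rcases hp.inf_le.1 h with h | h
  · obtain ⟨q, hq, hqp⟩ := L.exists_planesHyperplane_le h
    exact ⟨q, .inl hq, hqp⟩
  · obtain ⟨q, hq, hqp⟩ := L.exists_planesProduct_le h
    exact ⟨q, .inr hq, hqp⟩

theorem idealZ_le_of_mem_planes {q : Ideal CoordRing}
    (hq : q ∈ L.planesHyperplane ∪ L.planesProduct) : L.idealZ ≤ q := by
  rw [idealZ_eq]
  rcases hq with ((⟨h, rfl⟩ | ⟨h, rfl⟩) | ⟨h, rfl⟩) | ((⟨h, rfl⟩ | ⟨h, rfl⟩) | ⟨h, rfl⟩)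
  · exact (inf_le_left.trans (inf_le_left.trans inf_le_left)).trans
      (monomialIdeal_cylinder_le_planeIdeal h)
  · exact (inf_le_left.trans (inf_le_left.trans inf_le_right)).trans
      (monomialIdeal_cylinder_le_planeIdeal h)
  · exact (inf_le_left.trans inf_le_right).trans (monomialIdeal_cylinder_le_planeIdeal h)
  · exact (inf_le_right.trans inf_le_right).trans (monomialIdeal_cylinder_le_planeIdeal h)
  · exact (inf_le_right.trans (inf_le_left.trans inf_le_right)).trans
      (monomialIdeal_cylinder_le_planeIdeal h)
  · exact (inf_le_right.trans (inf_le_left.trans inf_le_left)).trans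
      (monomialIdeal_cylinder_le_planeIdeal h)

/-- A power of `x₄` vanishes on the first half, but is regular on the second half. -/
theorem exists_mem_idealHyperplane_regularModulo :
    ∃ h ∈ L.idealHyperplane, RegularModulo L.idealProduct h ∧
      ∀ p : Ideal CoordRing, p.IsPrime → h ∈ p → X 3 ∈ p := by
  set N := L.l12.rowLen 0 + L.l13.rowLen 0 + L.l23.rowLen 0
  refine ⟨X 3 ^ N, ?_, ?_, fun p hp h => hp.mem_of_pow_mem N h⟩
  · rw [idealHyperplane_eq, X_pow_eq_monomial]
    refine monomial_mem_monomialIdeal ?_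
    simp [π12, π13, π23, cylinder, YoungDiagram.mem_iff_lt_rowLen, N]
    omega
  · refine L.hasCyclicFiltration_idealProduct.regularModulo ?_
    have key : ∀ c d : Fin 4, 3 ≠ c → 3 ≠ d → RegularModulo (planeIdeal c d) (X 3 ^ N) := by
      intro c d hc hd
      refine .of_isPrime inferInstance fun hmem => ?_
      have hle : planeIdeal c d ≤ RingHom.ker (eval (Pi.single 3 (1 : ℂ))) :=
        planeIdeal_le_iff.2 ⟨by simp [RingHom.mem_ker, hc.symm], by simp [RingHom.mem_ker, hd.symm]⟩
      simpa [RingHom.mem_ker] using hle hmem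
    rintro q ((⟨-, rfl⟩ | ⟨-, rfl⟩) | ⟨-, rfl⟩) <;> exact key _ _ (by decide) (by decide)

theorem exists_pow_mul_pow_mem_idealProduct :
    ∃ N, N ≠ 0 ∧ X 0 ^ N * X 1 ^ N ∈ L.idealProduct ∧ X 0 ^ N * X 2 ^ N ∈ L.idealProduct ∧
      X 1 ^ N * X 2 ^ N ∈ L.idealProduct := by
  have key : ∀ (μ : YoungDiagram) (a b : ℕ), μ.colLen 0 ≤ a ∨ μ.rowLen 0 ≤ b → (a, b) ∉ μ := by
    rintro μ a b (h | h) hab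
    · exact absurd (YoungDiagram.mem_iff_lt_colLen.1 (μ.up_left_mem le_rfl (Nat.zero_le b) hab))
        h.not_gt
    · exact absurd (YoungDiagram.mem_iff_lt_rowLen.1 (μ.up_left_mem (Nat.zero_le a) le_rfl hab))
        h.not_gt
  set N := (L.l34.colLen 0 + L.l24.colLen 0 + L.l14.colLen 0) +
    (L.l34.rowLen 0 + L.l24.rowLen 0 + L.l14.rowLen 0) + 1
  refine ⟨N, by omega, ?_⟩
  simp only [idealProduct_eq, X_pow_eq_monomial, monomial_mul, mul_one]
  refine ⟨monomial_mem_monomialIdeal ?_, monomial_mem_monomialIdeal ?_,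
    monomial_mem_monomialIdeal ?_⟩ <;>
  · rintro ((h | h) | h) <;> refine key _ _ _ ?_ h <;> simp [N] <;> omega

/-- A combination of the monomials `(x_i x_j) ^ N`, `i < j ≤ 3`, vanishes on the second half, but is
regular on the first half. -/
theorem exists_mem_idealProduct_regularModulo :
    ∃ g ∈ L.idealProduct, RegularModulo L.idealHyperplane g := by
  obtain ⟨N, hN, h01, h02, h12⟩ := L.exists_pow_mul_pow_mem_idealProduct
  refine ⟨X 0 ^ N * X 1 ^ N + X 0 ^ N * X 2 ^ N + X 1 ^ N * X 2 ^ N,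
    Ideal.add_mem _ (Ideal.add_mem _ h01 h02) h12,
    L.hasCyclicFiltration_idealHyperplane.regularModulo ?_⟩
  have key : ∀ c : Fin 4, c ≠ 3 → RegularModulo (planeIdeal c 3)
      (X 0 ^ N * X 1 ^ N + X 0 ^ N * X 2 ^ N + X 1 ^ N * X 2 ^ N) := by
    intro c hc
    refine .of_isPrime inferInstance fun hmem => ?_
    -- evaluate at the point of the plane with its two free coordinates equal to `1`
    have hle : planeIdeal c 3 ≤ RingHom.ker (eval fun i => if i = c ∨ i = 3 then (0 : ℂ) else 1) :=
      planeIdeal_le_iff.2 ⟨by simp [RingHom.mem_ker], by simp [RingHom.mem_ker]⟩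
    have h := hle hmem
    fin_cases c <;> simp [RingHom.mem_ker, hN] at h hc
  rintro q ((⟨-, rfl⟩ | ⟨-, rfl⟩) | ⟨-, rfl⟩) <;> exact key _ (by decide)

/-! ### The intersection of the two halves -/

theorem exists_forall_ne_X_mem {p : Ideal CoordRing} [hp : p.IsPrime] (h : L.idealW ≤ p) :
    ∃ k, ∀ i ≠ k, X i ∈ p := by
  rw [idealW_eq, sup_le_iff] at h
  obtain ⟨g, hg, -, hX⟩ := L.exists_mem_idealHyperplane_regularModulo
  have h3 : X 3 ∈ p := hX p hp (h.1 hg)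
  obtain ⟨N, -, h01, h02, h12⟩ := L.exists_pow_mul_pow_mem_idealProduct
  have key : ∀ i j : Fin 4, X i ^ N * X j ^ N ∈ L.idealProduct → X i ∈ p ∨ X j ∈ p :=
    fun i j hij => (hp.mem_or_mem (h.2 hij)).imp (hp.mem_of_pow_mem N) (hp.mem_of_pow_mem N)
  have hall : ∀ k : Fin 4, (∀ i ≠ k, X i ∈ p) ↔
      ((0 ≠ k → X 0 ∈ p) ∧ (1 ≠ k → X 1 ∈ p) ∧ (2 ≠ k → X 2 ∈ p) ∧ (3 ≠ k → X 3 ∈ p)) := by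
    intro k
    simp [Fin.forall_fin_succ]
  have e01 := key _ _ h01
  have e02 := key _ _ h02
  have e12 := key _ _ h12
  by_cases h0 : X 0 ∈ p
  · by_cases h1 : X 1 ∈ p
    · exact ⟨2, (hall 2).2 (by simp [h0, h1, h3])⟩
    · exact ⟨1, (hall 1).2 (by simp [h0, e12.resolve_left h1, h3])⟩
  · exact ⟨0, (hall 0).2 (by simp [e01.resolve_left h0, e02.resolve_left h0, h3])⟩

theorem subschemeDim_idealW_le_one : subschemeDim L.idealW ≤ 1 := by
  rw [subschemeDim, ringKrullDim_le_iff_height_le]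
  intro P hP
  have h3 : ∀ p : Ideal CoordRing, p.IsPrime → L.idealW ≤ p → 3 ≤ p.height := by
    intro p hp h
    obtain ⟨k, hk⟩ := L.exists_forall_ne_X_mem h
    have hle : coordSubspaceIdeal 0 (Finset.univ.erase k) ≤ p :=
      coordSubspaceIdeal_le_iff.2 fun i hi => by simpa using hk i (Finset.ne_of_mem_erase hi)
    have hcard := card_le_height_coordSubspaceIdeal 0 (Finset.univ.erase k)
    rw [Finset.card_erase_of_mem (Finset.mem_univ k)] at hcard
    exact hcard.trans (Ideal.height_mono hle)
  have h := (height_add_le_height_comap h3 P).trans (height_le_four _)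
  have : P.height ≤ 1 := by
    have h4 : (4 : ℕ∞) = 1 + 3 := by norm_num
    rw [h4] at h
    exact (ENat.add_le_add_iff_right (by simp)).1 h
  exact_mod_cast this

theorem isMaximal_of_sumForm_mem (z : ℂ) {p : Ideal CoordRing} (hp : p.IsPrime)
    (h : L.idealW ≤ p) (hz : sumForm z ∈ p) : p.IsMaximal := by
  obtain ⟨k, hk⟩ := L.exists_forall_ne_X_mem h
  refine isMaximal_of_X_sub_C_mem hp.ne_top (Pi.single k z) fun i => ?_
  by_cases hi : i = k
  · subst hi
    have : X i - C ((Pi.single i z : Fin 4 → ℂ) i) = sumForm z - ∑ j ∈ Finset.univ.erase i, X j := by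
      rw [sumForm, ← Finset.add_sum_erase _ _ (Finset.mem_univ i), Pi.single_eq_same]
      ring
    rw [this]
    exact sub_mem hz (sum_mem fun j hj => hk j (Finset.ne_of_mem_erase hj))
  · simpa [Pi.single_eq_of_ne hi] using hk i hi

/-! ### The Cohen-Macaulay property of the union -/

/-- If the form `sumForm z` is regular on the intersection of the two halves for all `z`, then at
each closed point the two linear forms through it are a regular sequence on the union. At the other
points the dimension is at most one, and prime avoidance provides a regular element. -/
theorem subschemeIsCohenMacaulay_idealZ (hs : ∀ z, RegularModulo L.idealW (sumForm z)) :
    SubschemeIsCohenMacaulay L.idealZ := by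
  refine ⟨inferInstance, fun P hP => ?_⟩
  set p := P.comap (Ideal.Quotient.mk L.idealZ) with hpdef
  have hle_comap : ∀ Q : Ideal (CoordRing ⧸ L.idealZ),
      L.idealZ ≤ Q.comap (Ideal.Quotient.mk L.idealZ) := fun Q a ha => by
    simp [Ideal.mem_comap, Ideal.Quotient.eq_zero_iff_mem.2 ha]
  have h2 : ∀ p : Ideal CoordRing, p.IsPrime → L.idealZ ≤ p → 2 ≤ p.height := by
    intro p hp h
    obtain ⟨q, hq, hqp⟩ := L.exists_planes_le h
    obtain ⟨c, d, hcd, rfl⟩ := L.exists_eq_planeIdeal hq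
    exact (two_le_height_planeIdeal hcd).trans (Ideal.height_mono hqp)
  have hheight : P.height + 2 ≤ p.height := height_add_le_height_comap h2 P
  have hreg : ∀ r, (∀ q ∈ L.planesHyperplane ∪ L.planesProduct, RegularModulo q r) →
      RegularModulo L.idealZ r := by
    intro r hr
    rw [idealZ_eq]
    exact (L.hasCyclicFiltration_idealHyperplane.regularModulo fun q hq => hr q (.inl hq)).inf
      (L.hasCyclicFiltration_idealProduct.regularModulo fun q hq => hr q (.inr hq))
  by_cases hmax : p.IsMaximal
  · obtain ⟨z, hz⟩ := exists_sumForm_mem hmax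
    obtain ⟨w, hw⟩ := exists_weightedForm_mem hmax
    have hsum : ∀ q ∈ L.planesHyperplane ∪ L.planesProduct, RegularModulo q (sumForm z) := by
      intro q hq
      obtain ⟨c, d, -, rfl⟩ := L.exists_eq_planeIdeal hq
      exact regularModulo_planeIdeal_sumForm z
    have hweight : ∀ q ∈ L.planesHyperplane ∪ L.planesProduct,
        RegularModulo (q ⊔ Ideal.span {sumForm z}) (weightedForm w) := by
      intro q hq
      obtain ⟨c, d, hcd, rfl⟩ := L.exists_eq_planeIdeal hq
      exact regularModulo_planeIdeal_sup_weightedForm hcd z w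
    have hsecond : RegularModulo (L.idealZ ⊔ Ideal.span {sumForm z}) (weightedForm w) := by
      rw [idealZ_eq, inf_sup_span_singleton (L.idealW_eq ▸ hs z)]
      exact (L.hasCyclicFiltration_idealHyperplane.regularModulo_sup_span
          (fun q hq => hsum q (.inl hq)) (fun q hq => hweight q (.inl hq))).inf
        (L.hasCyclicFiltration_idealProduct.regularModulo_sup_span
          (fun q hq => hsum q (.inr hq)) (fun q hq => hweight q (.inr hq)))
    refine localDepth_eq_ringKrullDim_of_isWeaklyRegular P
      (isWeaklyRegular_pair_of_regularModulo (hreg _ hsum) hsecond) ?_ ?_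
    · intro r hr
      simp only [List.mem_cons, List.not_mem_nil, or_false] at hr
      rcases hr with rfl | rfl
      · exact hz
      · exact hw
    · have h := hheight.trans (height_le_four p)
      have h4 : (4 : ℕ∞) = 2 + 2 := by norm_num
      rw [h4] at h
      simpa using (ENat.add_le_add_iff_right (by simp)).1 h
  by_cases hq : ∃ q ∈ L.planesHyperplane ∪ L.planesProduct, p ≤ q
  · -- `p` is the generic point of a component
    refine localDepth_eq_ringKrullDim_of_isWeaklyRegular P (rs := []) (.nil _ _) (by simp) ?_
    obtain ⟨q, hq, hpq⟩ := hq
    obtain ⟨c, d, -, rfl⟩ := L.exists_eq_planeIdeal hq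
    suffices hmin : P ∈ minimalPrimes (CoordRing ⧸ L.idealZ) by
      rw [Ideal.height_eq_zero_iff.2 hmin]; simp
    refine ⟨⟨hP, bot_le⟩, fun Q hQ hQP => ?_⟩
    have := hQ.1
    obtain ⟨q', hq', hqQ⟩ := L.exists_planes_le (hle_comap Q)
    obtain ⟨c', d', hcd', rfl⟩ := L.exists_eq_planeIdeal hq'
    refine (Ideal.comap_le_comap_iff_of_surjective _ Ideal.Quotient.mk_surjective P Q).1 ?_
    exact (hpq.trans (planeIdeal_le_planeIdeal_symm hcd'
      ((hqQ.trans (Ideal.comap_mono hQP)).trans hpq))).trans hqQ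
  · have hfin : (L.planesHyperplane ∪ L.planesProduct).Finite :=
      (((finite_supportPlanes _ _ _).union (finite_supportPlanes _ _ _)).union
        (finite_supportPlanes _ _ _)).union
      (((finite_supportPlanes _ _ _).union (finite_supportPlanes _ _ _)).union
        (finite_supportPlanes _ _ _))
    have hprime : ∀ q ∈ L.planesHyperplane ∪ L.planesProduct, q.IsPrime := by
      intro q hq
      obtain ⟨c, d, -, rfl⟩ := L.exists_eq_planeIdeal hq
      infer_instance
    obtain ⟨r, hrp, hr⟩ : ∃ r ∈ p, ∀ q ∈ L.planesHyperplane ∪ L.planesProduct, r ∉ q := by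
      by_contra! hcon
      refine hq ((Ideal.subset_union_prime_finite hfin (f := id) ⊤ ⊤
        (fun q hq _ _ => hprime q hq)).1 fun r hr => ?_)
      obtain ⟨q, hq, hrq⟩ := hcon r hr
      exact Set.mem_biUnion hq hrq
    refine localDepth_eq_ringKrullDim_of_isWeaklyRegular P
      (isWeaklyRegular_singleton_of_regularModulo
        (hreg r fun q hq => .of_isPrime (hprime q hq) (hr q hq))) (by simpa using! hrp) ?_
    obtain ⟨m, hm, hpm⟩ := p.exists_le_maximal (Ideal.IsPrime.ne_top inferInstance)
    have hlt : p < m := lt_of_le_of_ne hpm (by rintro h; exact hmax (h ▸ hm))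
    have := hm.isPrime
    have h := (Ideal.height_add_one_le_of_lt_of_isPrime hlt).trans (height_le_four m)
    have h' : P.height + 3 ≤ 1 + 3 := by
      calc P.height + 3 = P.height + 2 + 1 := by rw [add_assoc]; norm_num
        _ ≤ p.height + 1 := by gcongr
        _ ≤ 4 := h
        _ = 1 + 3 := by norm_num
    simpa using (ENat.add_le_add_iff_right (by simp)).1 h'

/-- At a closed point whose maximal ideal annihilates a nonzero section of the structure sheaf of
the intersection of the two halves, the union has dimension two and depth at most one. -/
theorem not_subschemeIsCohenMacaulay_idealZ {J : Ideal (CoordRing ⧸ L.idealW)} (hJ : J ≠ ⊥)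
    (hdim : Module.supportDim (CoordRing ⧸ L.idealW) J ≤ 0) :
    ¬ SubschemeIsCohenMacaulay L.idealZ := by
  obtain ⟨f, hf, p, hmax, hp⟩ := exists_isMaximal_annihilator hJ hdim
  have hWp : L.idealW ≤ p := fun r hr => (hp r).2 (Ideal.mul_mem_right _ _ hr)
  rw [idealW_eq] at hf hp hWp
  obtain ⟨g, hgP, hg⟩ := L.exists_mem_idealProduct_regularModulo
  obtain ⟨h, hhH, hh, -⟩ := L.exists_mem_idealHyperplane_regularModulo
  have hprime := hmax.isPrime
  obtain ⟨q, hq, hqp⟩ := L.exists_planesHyperplane_le (le_sup_left.trans hWp)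
  have hZq := L.idealZ_le_of_mem_planes (.inl hq)
  obtain ⟨c, d, hcd, rfl⟩ := L.exists_eq_planeIdeal (.inl hq)
  rw [SubschemeIsCohenMacaulay]
  rw [idealZ_eq] at hZq ⊢
  have hZp := hZq.trans hqp
  rintro ⟨-, hCM⟩
  have hmk := Ideal.Quotient.mk_surjective (I := L.idealHyperplane ⊓ L.idealProduct)
  set P := p.map (Ideal.Quotient.mk (L.idealHyperplane ⊓ L.idealProduct)) with hPdef
  have hP : P.IsPrime := Ideal.map_isPrime_of_surjective hmk (by rwa [Ideal.mk_ker])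
  have hcomap : P.comap (Ideal.Quotient.mk (L.idealHyperplane ⊓ L.idealProduct)) = p := by
    rw [hPdef, Ideal.comap_map_of_surjective _ hmk, ← RingHom.ker_eq_comap_bot, Ideal.mk_ker,
      sup_eq_left.2 hZp]
  have hlt : localDepth (Localization.AtPrime P) < 2 :=
    localDepth_lt_two_of_socle P hf (hcomap.symm ▸ hmax)
      (fun r hr => (hp r).1 (hcomap ▸ hr)) hgP hg hhH hh
  have heq := hCM P
  rw [IsLocalization.AtPrime.ringKrullDim_eq_height P, WithBot.coe_inj] at heq
  rw [heq] at hlt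
  refine hlt.not_ge ?_
  -- the flag point, line, plane through the closed point bounds the height from below
  obtain ⟨v, hv⟩ := exists_X_sub_C_mem hmax
  obtain ⟨a, b, hac, had, hba, hbc, hbd⟩ : ∃ a b : Fin 4, a ≠ c ∧ a ≠ d ∧ b ≠ a ∧ b ≠ c ∧
      b ≠ d := by
    clear hq hqp hZq
    revert c d; decide
  have hvz : ∀ k, X k ∈ p → v k = 0 := by
    intro k hk
    by_contra hne
    apply hprime.ne_top
    refine Ideal.eq_top_of_isUnit_mem p (x := C (v k)) ?_ ((isUnit_iff_ne_zero.2 hne).map C)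
    simpa using sub_mem hk (hv k)
  obtain ⟨hXc, hXd⟩ := planeIdeal_le_iff.1 hqp
  have hZ0 : L.idealHyperplane ⊓ L.idealProduct ≤ coordSubspaceIdeal v {c, d} := by
    refine hZq.trans (planeIdeal_le_iff.2 ⟨?_, ?_⟩)
    · simpa [hvz c hXc] using X_sub_C_mem_coordSubspaceIdeal
        (v := v) (S := {c, d}) (i := c) (by simp)
    · simpa [hvz d hXd] using X_sub_C_mem_coordSubspaceIdeal
        (v := v) (S := {c, d}) (i := d) (by simp)
  refine exists_lt_lt_of_two_le_height hZ0
    (coordSubspaceIdeal_lt_insert v (a := a) (by simp [hac, had])) P ?_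
  rw [hcomap]
  exact (coordSubspaceIdeal_lt_insert v (a := b) (by simp [hba, hbc, hbd])).trans_le
    (coordSubspaceIdeal_le_iff.2 fun i _ => hv i)

end SixPartitions

theorem subschemeIsEmpty_iff_eq_top (I : Ideal CoordRing) : SubschemeIsEmpty I ↔ I = ⊤ := by
  rw [SubschemeIsEmpty, PrimeSpectrum.isEmpty_iff_subsingleton, Ideal.Quotient.subsingleton_iff]

theorem proposition5p2 (L : SixPartitions) (hL : L.NotAllEmpty) :
    -- the four cases are exhaustive
    (SubschemeIsEmpty L.idealW ∨ subschemeDim L.idealW = 0 ∨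
      (subschemeDim L.idealW = 1 ∧ ¬ SubschemeIsPure L.idealW) ∨
      (subschemeDim L.idealW = 1 ∧ SubschemeIsPure L.idealW)) ∧
    -- W empty
    (SubschemeIsEmpty L.idealW → SubschemeIsCohenMacaulay L.idealZ) ∧
    -- W of dimension 0
    (subschemeDim L.idealW = 0 → ¬ SubschemeIsCohenMacaulay L.idealZ) ∧
    -- W of dimension 1, impure
    (subschemeDim L.idealW = 1 ∧ ¬ SubschemeIsPure L.idealW →
      ¬ SubschemeIsCohenMacaulay L.idealZ) ∧
    -- W of dimension 1, pure
    (subschemeDim L.idealW = 1 ∧ SubschemeIsPure L.idealW →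
      SubschemeIsCohenMacaulay L.idealZ) ∧
    -- hence the criterion
    (SubschemeIsCohenMacaulay L.idealZ ↔
      SubschemeIsEmpty L.idealW ∨
        (subschemeDim L.idealW = 1 ∧ SubschemeIsPure L.idealW)) := by
  have hlt_one : ∀ d : WithBot ℕ∞, d ≤ 1 → d ≠ 1 → d ≤ 0 := by
    intro d h1 h2
    cases d with
    | bot => exact bot_le
    | coe d =>
      have : d < 1 := by exact_mod_cast lt_of_le_of_ne h1 h2
      rw [Order.lt_one_iff.1 this]
      rfl
  have hcases : SubschemeIsEmpty L.idealW ∨ subschemeDim L.idealW = 0 ∨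
      (subschemeDim L.idealW = 1 ∧ ¬ SubschemeIsPure L.idealW) ∨
      (subschemeDim L.idealW = 1 ∧ SubschemeIsPure L.idealW) := by
    by_cases hE : SubschemeIsEmpty L.idealW
    · exact .inl hE
    · rw [SubschemeIsEmpty, not_isEmpty_iff] at hE
      have h0 : 0 ≤ subschemeDim L.idealW := Order.krullDim_nonneg_iff.2 hE
      by_cases h1 : subschemeDim L.idealW = 1
      · by_cases hp : SubschemeIsPure L.idealW
        · exact .inr (.inr (.inr ⟨h1, hp⟩))
        · exact .inr (.inr (.inl ⟨h1, hp⟩))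
      · exact .inr (.inl (le_antisymm (hlt_one _ L.subschemeDim_idealW_le_one h1) h0))
  have hempty : SubschemeIsEmpty L.idealW → SubschemeIsCohenMacaulay L.idealZ := by
    intro hE
    rw [subschemeIsEmpty_iff_eq_top] at hE
    exact L.subschemeIsCohenMacaulay_idealZ fun z f _ => hE ▸ Submodule.mem_top
  have hzero : subschemeDim L.idealW = 0 → ¬ SubschemeIsCohenMacaulay L.idealZ := by
    intro h0
    refine L.not_subschemeIsCohenMacaulay_idealZ (J := ⊤) ?_
      ((Module.supportDim_le_ringKrullDim _ _).trans h0.le)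
    intro htop
    have : Subsingleton (CoordRing ⧸ L.idealW) :=
      (Submodule.subsingleton_iff _).1 (subsingleton_of_bot_eq_top htop.symm)
    rw [subschemeDim, ringKrullDim_eq_bot_of_subsingleton] at h0
    exact absurd h0 (by simp)
  have himpure : subschemeDim L.idealW = 1 ∧ ¬ SubschemeIsPure L.idealW →
      ¬ SubschemeIsCohenMacaulay L.idealZ := by
    rintro ⟨h1, hp⟩
    simp only [SubschemeIsPure, IsPureRing, not_forall] at hp
    obtain ⟨J, hJ, hne⟩ := hp
    rw [subschemeDim] at h1
    rw [h1] at hne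
    exact L.not_subschemeIsCohenMacaulay_idealZ hJ
      (hlt_one _ ((Module.supportDim_le_ringKrullDim _ _).trans h1.le) hne)
  have hpure : subschemeDim L.idealW = 1 ∧ SubschemeIsPure L.idealW →
      SubschemeIsCohenMacaulay L.idealZ := fun ⟨h1, hp⟩ =>
    L.subschemeIsCohenMacaulay_idealZ fun z => .of_isPureRing hp h1 fun _ hq hW hz =>
      L.isMaximal_of_sumForm_mem z hq hW hz
  refine ⟨hcases, hempty, hzero, himpure, hpure, fun hCM => ?_, fun h => h.elim hempty hpure⟩
  rcases hcases with h | h | h | h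
  · exact .inl h
  · exact absurd hCM (hzero h)
  · exact absurd hCM (himpure h)
  · exact .inr h
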